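/- Let $q$ be an indeterminate. For $k\ge 0$ write $(a;x)_k=\prod_{j=0}^{k-1}(1-ax^j)$ and $(a_1,\dots,a_r;x)_k=(a_1;x)_k\cdots(a_r;x)_k$; for an integer $m$ write $[m]_{x}=(1-x^m)/(1-x)$; let $\Phi_n$ denote the $n$-th cyclotomic polynomial. For rational functions $A,B\in\mathbb{Q}(q)$ and a polynomial $P\in\mathbb{Q}[q]$, the congruence $A\equiv B \pmod{P}$ means that $P$ divides, in $\mathbb{Q}[q]$, the numerator of the reduced form of $A-B$. Let $s\in\{1,-1\}$ and let $n$ be a positive integer with $n\equiv s\pmod 4$. Then, modulo $\Phi_n(-q)^3\,\Phi_n(q)^2$, $$ \sum_{k=0}^{(n-s)/4}(-1)^{k}\, \frac{(1+q^{8k+s})\,(q^{2s};q^{8})_{k}^{3}}{(1+q^s)\,(q^{8};q^{8})_{k}^{3}}\; q^{4k^2+2k(4-s)} \;\equiv\;(-1)^{(n-s)/4}\,\frac{[n]_{q^2}}{[s]_{q^2}}\;q^{(n-s)(n+s-4)/4}\sum_{k=0}^{(n-s)/4} \frac{(q^{2s};q^{8})_{k}^{2}\,(q^{4};q^{8})_{k}}{(q^{8},q^{4+s},q^{8+s};q^{8})_{k}}\;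 q^{2k(4-s)} . $$ -/

import Mathlib

open Polynomial

/-- The `q`-shifted factorial `(a; x)_k = (1 - a) (1 - a x) ⋯ (1 - a x ^ (k - 1))` for `k ≥ 0`. -/
def qShiftedFactorial {K : Type*} [Field K] (a x : K) (k : ℕ) : K :=
  ∏ j ∈ Finset.range k, (1 - a * x ^ j)

/-- The `q`-integer `[m]_x = (1 - x ^ m) / (1 - x)`, for an integer `m` (possibly negative). -/
def qInteger {K : Type*} [Field K] (x : K) (m : ℤ) : K :=
  (1 - x ^ m) / (1 - x)

/-- Two rational functions `A`, `B` in the variable `q` with rational coefficients are congruent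
modulo a polynomial `P` if `P` divides the numerator of the reduced form of `A - B`. -/
def RatFuncCongruent (P : ℚ[X]) (A B : RatFunc ℚ) : Prop :=
  P ∣ (A - B).num

/-! ### Finite `q`-series: `q`-Chu–Vandermonde, a Bailey pair, and a limit of Watson's
transformation. -/

section QSeries

variable {K : Type*} [Field K]

/-! Write `n = 4N + s` and deform both sides by a parameter `x`: two of the factors `(q^{2s};
q^8)_k` become `(q^{2s} x; q^8)_k` and `(q^{2s} x⁻¹; q^8)_k`, and on the left two of the `(q^8;
q^8)_k` become `(q^8 x; q^8)_k` and `(q^8 x⁻¹; q^8)_k`. The difference of the two sides, cleared of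
its `x`-dependent denominators, is a polynomial `F` in `y = x + x⁻¹`. The theorem concerns `x = 1`,
that is, `y = 2`.

At `x = q^{2n}` both sums terminate naturally and agree exactly, by a limiting case of Watson's
transformation (`watson_transformation`, `watson_specialised`). For this `x` one has `2 - y = -x⁻¹
(1 - x)²`, which is divisible by the square of both `Φ_n(q)` and `Φ_n(-q)`. Since `2 - y` divides
`F(2) - F(y) = F(2)`, the congruence holds modulo both squares.

The third power of `Φ_n(-q)` comes from `F` vanishing identically modulo `Φ_n(-q)`. At a root `ω`
one has `ω^n = -1`; the left sum is then antisymmetric under `k ↦ N - k` (`clearedSeries_eq_zero`),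
while on the right the factor `1 - q^{2n}` loses at most `1 - q^n` to the denominators and keeps `1
+ q^n` (`exists_regular_quotient`). Hence `F = π G` with `π = Φ_n(-q)`, and the square argument
applied to `G` gives `π³`.

Denominators are handled in the localization of `ℚ[X]` at the polynomials not vanishing at `ω`
(`exists_cleared_difference`, `pow_dvd_num_seriesDifference`); the two moduli are coprime because
`n` is odd. -/

theorem qShiftedFactorial_zero (a x : K) : qShiftedFactorial a x 0 = 1 := by
  simp [qShiftedFactorial]

theorem qShiftedFactorial_succ (a x : K) (k : ℕ) :
    qShiftedFactorial a x (k + 1) = qShiftedFactorial a x k * (1 - a * x ^ k) := by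
  simp [qShiftedFactorial, Finset.prod_range_succ]

theorem qShiftedFactorial_add (a x : K) (m k : ℕ) :
    qShiftedFactorial a x (m + k) =
      qShiftedFactorial a x m * qShiftedFactorial (a * x ^ m) x k := by
  simp only [qShiftedFactorial, Finset.prod_range_add]
  congr 1
  exact Finset.prod_congr rfl fun j _ => by rw [pow_add, mul_assoc]

theorem qShiftedFactorial_succ_left (a x : K) (k : ℕ) :
    qShiftedFactorial a x (k + 1) = (1 - a) * qShiftedFactorial (a * x) x k := by
  rw [add_comm, qShiftedFactorial_add]
  simp [qShiftedFactorial]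

theorem qShiftedFactorial_ne_zero {a x : K} {k : ℕ} (h : ∀ j < k, 1 - a * x ^ j ≠ 0) :
    qShiftedFactorial a x k ≠ 0 :=
  Finset.prod_ne_zero_iff.2 fun j hj => h j (Finset.mem_range.1 hj)

theorem qShiftedFactorial_inv_pow_eq_zero {p : K} (hp : p ≠ 0) {n r : ℕ} (h : n < r) :
    qShiftedFactorial ((p ^ n)⁻¹) p r = 0 :=
  Finset.prod_eq_zero (Finset.mem_range.2 h) (by
    rw [inv_mul_cancel₀ (pow_ne_zero _ hp), sub_self])

/-- The indefinite sum behind the `q`-Chu–Vandermonde sum. -/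
theorem vandermonde_telescoping (p d t ν : K)
    (hpj : ∀ j : ℕ, 1 - p * p ^ j ≠ 0) (hyj : ∀ j : ℕ, 1 - t * (d * ν * p) * p ^ j ≠ 0)
    (hν1 : 1 - ν ≠ 0) (ht : 1 - t ≠ 0) (r : ℕ) :
    ∑ m ∈ Finset.range r,
      ((1 - t * d) / (1 - t) *
        (qShiftedFactorial d p m * qShiftedFactorial ν p m /
          (qShiftedFactorial p p m * qShiftedFactorial (t * (d * ν * p)) p m) * (t * p) ^ m) -
        qShiftedFactorial d p m * qShiftedFactorial (ν * p) p m /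
          (qShiftedFactorial p p m * qShiftedFactorial (t * (d * ν * p)) p m) * t ^ m) =
    qShiftedFactorial d p r * qShiftedFactorial ν p r /
          (qShiftedFactorial p p r * qShiftedFactorial (t * (d * ν * p)) p r) * t ^ r *
      ((1 - p ^ r) * (1 - t * d * ν * p ^ r) / ((1 - ν) * (1 - t))) := by
  induction r with
  | zero => simp
  | succ r ih =>
    have hP : qShiftedFactorial p p r ≠ 0 := qShiftedFactorial_ne_zero fun j _ => hpj j
    have hY : qShiftedFactorial (t * (d * ν * p)) p r ≠ 0 :=
      qShiftedFactorial_ne_zero fun j _ => hyj j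
    have h1 := hpj r
    have h2 := hyj r
    have e1 : qShiftedFactorial (ν * p) p r =
        qShiftedFactorial ν p r * (1 - ν * p ^ r) / (1 - ν) := by
      rw [eq_div_iff hν1, ← qShiftedFactorial_succ, qShiftedFactorial_succ_left, mul_comm]
    rw [Finset.sum_range_succ, ih, e1, mul_pow]
    simp only [qShiftedFactorial_succ, pow_succ]
    clear ih e1 hpj hyj
    generalize t ^ r = c
    generalize qShiftedFactorial p p r = A at *
    generalize qShiftedFactorial (t * (d * ν * p)) p r = B at *
    generalize qShiftedFactorial d p r = D
    generalize qShiftedFactorial ν p r = E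
    generalize p ^ r = X at *
    generalize hu : 1 - p * X = u at *
    generalize hv : 1 - t * (d * ν * p) * X = v at *
    field_simp
    rw [← hu, ← hv]
    ring

/-- The `q`-Chu–Vandermonde sum. -/
theorem q_vandermonde (p d y : K) (hd : d ≠ 0) (hp : p ≠ 0)
    (hpj : ∀ j : ℕ, 1 - p * p ^ j ≠ 0) (hyj : ∀ j : ℕ, 1 - y * p ^ j ≠ 0)
    (hc : ∀ j : ℕ, 1 - y / d * p ^ j ≠ 0) (M : ℕ) :
    ∑ m ∈ Finset.range (M + 1),
        qShiftedFactorial d p m * qShiftedFactorial ((p ^ M)⁻¹) p m /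
          (qShiftedFactorial p p m * qShiftedFactorial y p m) * (y * p ^ M / d) ^ m =
      qShiftedFactorial (y / d) p M / qShiftedFactorial y p M := by
  induction M with
  | zero => simp [qShiftedFactorial_zero]
  | succ M ih =>
    have hpM : p ^ M ≠ 0 := pow_ne_zero _ hp
    have hcM := hc M
    have e0 : (p ^ (M + 1))⁻¹ * p = (p ^ M)⁻¹ := by
      rw [pow_succ]; field_simp
    have hν1 : 1 - (p ^ (M + 1))⁻¹ ≠ 0 := by
      intro h
      apply hpj M
      rw [sub_eq_zero] at h
      have : p ^ (M + 1) = 1 := by rw [← inv_inv (p ^ (M + 1)), ← h, inv_one]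
      rw [← pow_succ', this, sub_self]
    have hy : y / d * p ^ M * (d * (p ^ (M + 1))⁻¹ * p) = y := by
      rw [mul_assoc d, e0]; field_simp
    -- For `ν = p^{-(M+1)}` the boundary term at `r = M + 2` contains `(ν; p)_{M+2} = 0`, so the
    -- telescoped identity becomes a two-term recurrence between the sums for `M + 1` and `M`.
    have key := vandermonde_telescoping p d (y / d * p ^ M) _ hpj (by rwa [hy]) hν1 hcM
      (M + 1 + 1)
    rw [qShiftedFactorial_inv_pow_eq_zero hp (lt_add_one _), Finset.sum_sub_distrib,
      ← Finset.mul_sum] at key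
    simp only [mul_zero, zero_div, zero_mul, sub_eq_zero] at key
    have e4 : ∑ m ∈ Finset.range (M + 1 + 1),
        qShiftedFactorial d p m * qShiftedFactorial ((p ^ M)⁻¹) p m /
          (qShiftedFactorial p p m * qShiftedFactorial y p m) * (y / d * p ^ M) ^ m =
        qShiftedFactorial (y / d) p M / qShiftedFactorial y p M := by
      -- The extra term `m = M + 1` vanishes because `(p^{-M}; p)_{M+1} = 0`.
      rw [Finset.sum_range_succ, qShiftedFactorial_inv_pow_eq_zero hp (lt_add_one _), ← ih]
      simp only [mul_zero, zero_div, zero_mul, add_zero, div_mul_eq_mul_div]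
    have e5 : y / d * p ^ M * p = y * p ^ (M + 1) / d := by ring
    have e6 : 1 - y / d * p ^ M * d = 1 - y * p ^ M := by field_simp
    rw [hy, e0, e4, e5, e6] at key
    have hY : qShiftedFactorial y p M ≠ 0 := qShiftedFactorial_ne_zero fun j _ => hyj j
    have hyM := hyj M
    rw [div_mul_eq_mul_div, div_eq_div_iff hcM hY] at key
    rw [qShiftedFactorial_succ, qShiftedFactorial_succ, eq_div_iff (mul_ne_zero hY hyM)]
    linear_combination key
/-- The indefinite sum behind the Bailey pair used in `bailey_pair_sum`. -/
theorem bailey_telescoping (h α t : K) (hh : h ≠ 0) (ht : t ≠ 0)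
    (hpj : ∀ j : ℕ, 1 - h ^ 2 * (h ^ 2) ^ j ≠ 0)
    (hyj : ∀ j : ℕ, 1 - α ^ 2 * t * h * (h ^ 2) ^ j ≠ 0)
    (hα : 1 + α ≠ 0) (hth : t * h - 1 ≠ 0) (ht1 : 1 - t ≠ 0) (r : ℕ) :
    ∑ m ∈ Finset.range r,
      ((1 - α * t) * (1 - α * t * h) / ((1 - α ^ 2 * t * h) * (1 - t)) *
        ((1 + α * (h ^ 2) ^ m) / (1 + α) *
          (qShiftedFactorial (α ^ 2) (h ^ 2) m * qShiftedFactorial ((t * h)⁻¹) (h ^ 2) m /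
          (qShiftedFactorial (h ^ 2) (h ^ 2) m *
            qShiftedFactorial (α ^ 2 * t * h * h ^ 2) (h ^ 2) m)) * (t * h ^ 2) ^ m) -
        (1 + α * (h ^ 2) ^ m) / (1 + α) *
          (qShiftedFactorial (α ^ 2) (h ^ 2) m * qShiftedFactorial ((t * h)⁻¹ * h ^ 2) (h ^ 2) m /
          (qShiftedFactorial (h ^ 2) (h ^ 2) m *
            qShiftedFactorial (α ^ 2 * t * h) (h ^ 2) m)) * t ^ m) =
    qShiftedFactorial (α ^ 2) (h ^ 2) r * qShiftedFactorial ((t * h)⁻¹) (h ^ 2) r /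
          (qShiftedFactorial (h ^ 2) (h ^ 2) r *
            qShiftedFactorial (α ^ 2 * t * h) (h ^ 2) r) * t ^ r *
      ((1 - (h ^ 2) ^ r) * (h - α * (h ^ 2) ^ r) * t / ((1 + α) * (t * h - 1) * (1 - t))) := by
  induction r with
  | zero => simp
  | succ r ih =>
    have hP : qShiftedFactorial (h ^ 2) (h ^ 2) r ≠ 0 := qShiftedFactorial_ne_zero fun j _ => hpj j
    have hY : qShiftedFactorial (α ^ 2 * t * h) (h ^ 2) r ≠ 0 :=
      qShiftedFactorial_ne_zero fun j _ => hyj j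
    have h0 := hyj 0
    rw [pow_zero, mul_one] at h0
    have h1 := hpj r
    have h2 := hyj r
    have e1 : qShiftedFactorial ((t * h)⁻¹ * h ^ 2) (h ^ 2) r =
        qShiftedFactorial ((t * h)⁻¹) (h ^ 2) r * ((t * h - (h ^ 2) ^ r) / (t * h - 1)) := by
      have := qShiftedFactorial_succ_left ((t * h)⁻¹) (h ^ 2) r
      rw [qShiftedFactorial_succ] at this
      field_simp at this ⊢
      linear_combination -this
    have e2 : qShiftedFactorial (α ^ 2 * t * h * h ^ 2) (h ^ 2) r =
        qShiftedFactorial (α ^ 2 * t * h) (h ^ 2) r * (1 - α ^ 2 * t * h * (h ^ 2) ^ r) /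
          (1 - α ^ 2 * t * h) := by
      rw [eq_div_iff h0, ← qShiftedFactorial_succ, qShiftedFactorial_succ_left, mul_comm]
    rw [Finset.sum_range_succ, ih, e1, e2, mul_pow]
    simp only [qShiftedFactorial_succ, pow_succ _ r]
    clear ih e1 e2 hpj hyj
    generalize t ^ r = c
    generalize qShiftedFactorial (h ^ 2) (h ^ 2) r = A at *
    generalize qShiftedFactorial (α ^ 2 * t * h) (h ^ 2) r = B at *
    generalize qShiftedFactorial (α ^ 2) (h ^ 2) r = D
    generalize qShiftedFactorial ((t * h)⁻¹) (h ^ 2) r = E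
    generalize (h ^ 2) ^ r = X at *
    generalize hu : 1 - h ^ 2 * X = u at *
    generalize hv : 1 - α ^ 2 * t * h * X = v at *
    generalize hw : 1 - α ^ 2 * t * h = w at *
    generalize hz : t * h - 1 = z at *
    field_simp
    rw [← hu, ← hv]
    have : w ≠ 0 := h0
    subst hw hz
    ring

/-- With `p = h²` and `a = α²` this is the terminating very-well-poised `₆φ₅` sum at parameters `√a`
and `√(ap)`: the second cancels against its own denominator, and the first turns `(1 - a p^{2r}) /
(1 - a)` into `(1 + α p^r) / (1 + α)`. The telescoped identity at `t = h p^n` gives a recurrence in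
`n`, since its boundary term vanishes. -/
theorem bailey_pair_sum (h α : K) (hh : h ≠ 0)
    (hpj : ∀ j : ℕ, 1 - h * h ^ j ≠ 0)
    (hyj : ∀ j : ℕ, 1 - α ^ 2 * h * h ^ j ≠ 0)
    (hαj : ∀ j : ℕ, 1 - α * h * h ^ j ≠ 0)
    (hα : 1 + α ≠ 0) (n : ℕ) :
    ∑ r ∈ Finset.range (n + 1),
        (1 + α * (h ^ 2) ^ r) / (1 + α) *
          (qShiftedFactorial (α ^ 2) (h ^ 2) r * qShiftedFactorial (((h ^ 2) ^ n)⁻¹) (h ^ 2) r /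
          (qShiftedFactorial (h ^ 2) (h ^ 2) r *
            qShiftedFactorial (α ^ 2 * (h ^ 2) ^ (n + 1)) (h ^ 2) r)) * (h * (h ^ 2) ^ n) ^ r =
      qShiftedFactorial (α ^ 2 * h ^ 2) (h ^ 2) n * qShiftedFactorial h (h ^ 2) n /
        (qShiftedFactorial (α * h) (h ^ 2) n * qShiftedFactorial (α * h ^ 2) (h ^ 2) n) := by
  have hp : h ^ 2 ≠ 0 := pow_ne_zero _ hh
  have hp2 : ∀ j : ℕ, 1 - h ^ 2 * (h ^ 2) ^ j ≠ 0 := fun j => by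
    rw [show h ^ 2 * (h ^ 2) ^ j = h * h ^ (2 * j + 1) by ring]; exact hpj _
  induction n with
  | zero => simp [qShiftedFactorial_zero, hα]
  | succ n ih =>
    have ht : h * (h ^ 2) ^ n ≠ 0 := mul_ne_zero hh (pow_ne_zero _ hp)
    have eP : h * (h ^ 2) ^ n * h = (h ^ 2) ^ (n + 1) := by ring
    have e0 : ((h ^ 2) ^ (n + 1))⁻¹ * h ^ 2 = ((h ^ 2) ^ n)⁻¹ := by
      rw [pow_succ]; field_simp
    have key := bailey_telescoping h α (h * (h ^ 2) ^ n) hh ht hp2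
      (fun j => by
        rw [show α ^ 2 * (h * (h ^ 2) ^ n) * h * (h ^ 2) ^ j =
          α ^ 2 * h * h ^ (2 * n + 1 + 2 * j) by ring]; exact hyj _) hα
      (by
        rw [← neg_ne_zero, neg_sub, eP, show (h ^ 2) ^ (n + 1) = h * h ^ (2 * n + 1) by ring]
        exact hpj _)
      (by rw [show h * (h ^ 2) ^ n = h * h ^ (2 * n) by ring]; exact hpj _) (n + 1 + 1)
    simp only [mul_assoc (α ^ 2) (h * (h ^ 2) ^ n) h] at key
    rw [eP, qShiftedFactorial_inv_pow_eq_zero hp (lt_add_one _), Finset.sum_sub_distrib,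
      ← Finset.mul_sum] at key
    simp only [mul_zero, zero_div, zero_mul, sub_eq_zero] at key
    rw [e0] at key
    have e4 : ∑ r ∈ Finset.range (n + 1 + 1),
        (1 + α * (h ^ 2) ^ r) / (1 + α) *
          (qShiftedFactorial (α ^ 2) (h ^ 2) r * qShiftedFactorial (((h ^ 2) ^ n)⁻¹) (h ^ 2) r /
          (qShiftedFactorial (h ^ 2) (h ^ 2) r *
            qShiftedFactorial (α ^ 2 * (h ^ 2) ^ (n + 1)) (h ^ 2) r)) * (h * (h ^ 2) ^ n) ^ r =
      qShiftedFactorial (α ^ 2 * h ^ 2) (h ^ 2) n * qShiftedFactorial h (h ^ 2) n /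
        (qShiftedFactorial (α * h) (h ^ 2) n * qShiftedFactorial (α * h ^ 2) (h ^ 2) n) := by
      rw [Finset.sum_range_succ, qShiftedFactorial_inv_pow_eq_zero hp (lt_add_one _), ← ih]
      simp only [mul_zero, zero_div, zero_mul, add_zero]
    have e5 : α ^ 2 * (h ^ 2) ^ (n + 1) * h ^ 2 = α ^ 2 * (h ^ 2) ^ (n + 1 + 1) := by ring
    have e6 : h * (h ^ 2) ^ n * h ^ 2 = h * (h ^ 2) ^ (n + 1) := by ring
    rw [e4, e5, e6] at key
    have n1 : qShiftedFactorial (α * h) (h ^ 2) n ≠ 0 := qShiftedFactorial_ne_zero fun j _ => by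
      rw [← pow_mul]; exact hαj _
    have n2 : qShiftedFactorial (α * h ^ 2) (h ^ 2) n ≠ 0 :=
      qShiftedFactorial_ne_zero fun j _ => by
        rw [show α * h ^ 2 * (h ^ 2) ^ j = α * h * h ^ (2 * j + 1) by ring]; exact hαj _
    have m1 : 1 - α * h * (h ^ 2) ^ n ≠ 0 := by rw [← pow_mul]; exact hαj _
    have m2 : 1 - α * h ^ 2 * (h ^ 2) ^ n ≠ 0 := by
      rw [show α * h ^ 2 * (h ^ 2) ^ n = α * h * h ^ (2 * n + 1) by ring]; exact hαj _
    have m3 : 1 - α ^ 2 * h ^ 2 * (h ^ 2) ^ n ≠ 0 := by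
      rw [show α ^ 2 * h ^ 2 * (h ^ 2) ^ n = α ^ 2 * h * h ^ (2 * n + 1) by ring]; exact hyj _
    have m4 : 1 - h * (h ^ 2) ^ n ≠ 0 := by rw [← pow_mul]; exact hpj _
    have e7 : (1 - α * (h * (h ^ 2) ^ n)) * (1 - α * (h * (h ^ 2) ^ n) * h) /
        ((1 - α ^ 2 * (h ^ 2) ^ (n + 1)) * (1 - h * (h ^ 2) ^ n)) =
        (1 - α * h * (h ^ 2) ^ n) * (1 - α * h ^ 2 * (h ^ 2) ^ n) /
        ((1 - α ^ 2 * h ^ 2 * (h ^ 2) ^ n) * (1 - h * (h ^ 2) ^ n)) := by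
      congr 2 <;> ring
    rw [e7, div_mul_eq_mul_div, div_eq_div_iff (mul_ne_zero m3 m4) (mul_ne_zero n1 n2)] at key
    simp only [qShiftedFactorial_succ]
    rw [eq_div_iff (mul_ne_zero (mul_ne_zero n1 m1) (mul_ne_zero n2 m2))]
    linear_combination key

/-- Reversal of `(p ^ (-(r + m)); p)_r`. -/
theorem qShiftedFactorial_inv_pow_mul (p : K) (hp : p ≠ 0) (r m : ℕ) :
    qShiftedFactorial ((p ^ (r + m))⁻¹) p r * p ^ ((r + m) * r) =
      (-1) ^ r * p ^ (r * (r - 1) / 2) * qShiftedFactorial (p * p ^ m) p r := by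
  induction r with
  | zero => simp [qShiftedFactorial_zero]
  | succ r ih =>
    have hq : p ^ (r + m) ≠ 0 := pow_ne_zero _ hp
    have e : (p ^ (r + 1 + m))⁻¹ * p = (p ^ (r + m))⁻¹ := by
      rw [show r + 1 + m = r + m + 1 by ring, pow_succ]; field_simp
    have e2 : (r + 1) * (r + 1 - 1) / 2 = r * (r - 1) / 2 + r := by
      rw [← Nat.choose_two_right, ← Nat.choose_two_right, Nat.choose_succ_succ' r 1,
        Nat.choose_one_right, add_comm]
    rw [qShiftedFactorial_succ_left, e, e2, qShiftedFactorial_succ]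
    have e3 : (1 - (p ^ (r + 1 + m))⁻¹) * p ^ (r + 1 + m) = p ^ (r + 1 + m) - 1 := by
      have : p ^ (r + 1 + m) ≠ 0 := pow_ne_zero _ hp
      field_simp
    have e4 : p ^ ((r + 1 + m) * (r + 1)) = p ^ (r + 1 + m) * (p ^ ((r + m) * r) * p ^ r) := by ring
    rw [e4]
    linear_combination (p ^ r * (qShiftedFactorial ((p ^ (r + m))⁻¹) p r * p ^ ((r + m) * r))) * e3 +
      (p ^ r * (p ^ (r + 1 + m) - 1)) * ih
-- This is the inner sum left by interchanging summations in Watson's transformation. Terms with `n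
-- < r` vanish through `(p^{-n}; p)_r`; the rest form a `q`-Chu–Vandermonde sum.
theorem watson_inner_sum (p a d g : K) (hp : p ≠ 0) (hd : d ≠ 0)
    (hpj : ∀ j : ℕ, 1 - p * p ^ j ≠ 0) (hyj : ∀ j : ℕ, 1 - a * p * p ^ j ≠ 0)
    (hc : ∀ j : ℕ, 1 - a * p / d * p ^ j ≠ 0) (N r : ℕ) (hr : r ≤ N) :
    ∑ n ∈ Finset.range (N + 1),
      qShiftedFactorial d p n * qShiftedFactorial ((p ^ N)⁻¹) p n * (a * p ^ (N + 1) / d) ^ n /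
        (qShiftedFactorial p p n * qShiftedFactorial (a * p) p n) *
        (qShiftedFactorial ((p ^ n)⁻¹) p r / qShiftedFactorial (a * p ^ (n + 1)) p r *
          (g * p ^ n) ^ r) =
    qShiftedFactorial (a * p / d) p N / qShiftedFactorial (a * p) p N *
      (qShiftedFactorial d p r * qShiftedFactorial ((p ^ N)⁻¹) p r /
        (qShiftedFactorial (a * p / d) p r * qShiftedFactorial (a * p ^ (N + 1)) p r) *
        ((-1) ^ r * g ^ r * p ^ (r * (r - 1) / 2) * (a * p ^ (N + 1) / d) ^ r)) := by
  obtain ⟨M, rfl⟩ := Nat.exists_eq_add_of_le hr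
  have nzp : ∀ k : ℕ, p ^ k ≠ 0 := fun k => pow_ne_zero _ hp
  have nP : ∀ k, qShiftedFactorial p p k ≠ 0 := fun k => qShiftedFactorial_ne_zero fun j _ => hpj j
  have nA : ∀ i k, qShiftedFactorial (a * p * p ^ i) p k ≠ 0 := fun i k =>
    qShiftedFactorial_ne_zero fun j _ => by
      rw [mul_assoc, ← pow_add]; exact hyj _
  have nA0 : ∀ k, qShiftedFactorial (a * p) p k ≠ 0 := fun k => by
    simpa using nA 0 k
  have nC : ∀ i k, qShiftedFactorial (a * p / d * p ^ i) p k ≠ 0 := fun i k =>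
    qShiftedFactorial_ne_zero fun j _ => by
      rw [mul_assoc, ← pow_add]; exact hc _
  have nC0 : ∀ k, qShiftedFactorial (a * p / d) p k ≠ 0 := fun k => by
    simpa using nC 0 k
  -- After the shift `n = r + m`, the product `(ap; p)_{r+m} (a p^{r+m+1}; p)_r` is `(ap;
  -- p)_{2r+m}`, whence the lower parameter `a p^{2r+1}`.
  have key := q_vandermonde p (d * p ^ r) (a * p * p ^ (r + r)) (mul_ne_zero hd (nzp r)) hp hpj
    (fun j => by rw [mul_assoc, ← pow_add]; exact hyj _)
    (fun j => by
      rw [show a * p * p ^ (r + r) / (d * p ^ r) * p ^ j = a * p / d * p ^ (r + j) by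
        have := nzp r
        rw [pow_add, pow_add]; field_simp]
      exact hc _) M
  rw [show Finset.range (r + M + 1) = Finset.range (r + (M + 1)) from rfl, Finset.sum_range_add,
    Finset.sum_eq_zero, zero_add]
  · have ez : a * p * p ^ (r + r) * p ^ M / (d * p ^ r) = a * p ^ (r + M + 1) / d := by
      have := nzp r
      simp only [pow_add, pow_one]; field_simp
    have ey : a * p * p ^ (r + r) / (d * p ^ r) = a * p / d * p ^ r := by
      have := nzp r
      rw [pow_add]; field_simp
    rw [ez, ey] at key
    have term : ∀ m,
      qShiftedFactorial d p (r + m) * qShiftedFactorial ((p ^ (r + M))⁻¹) p (r + m) *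
          (a * p ^ (r + M + 1) / d) ^ (r + m) /
        (qShiftedFactorial p p (r + m) * qShiftedFactorial (a * p) p (r + m)) *
        (qShiftedFactorial ((p ^ (r + m))⁻¹) p r / qShiftedFactorial (a * p ^ (r + m + 1)) p r *
          (g * p ^ (r + m)) ^ r) =
      qShiftedFactorial d p r * qShiftedFactorial ((p ^ (r + M))⁻¹) p r *
          (a * p ^ (r + M + 1) / d) ^ r * g ^ r * ((-1) ^ r * p ^ (r * (r - 1) / 2)) /
          qShiftedFactorial (a * p) p (r + r) *
        (qShiftedFactorial (d * p ^ r) p m * qShiftedFactorial ((p ^ M)⁻¹) p m /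
          (qShiftedFactorial p p m * qShiftedFactorial (a * p * p ^ (r + r)) p m) *
          (a * p ^ (r + M + 1) / d) ^ m) := fun m => by
      have e1 : (p ^ (r + M))⁻¹ * p ^ r = (p ^ M)⁻¹ := by
        have := nzp r
        rw [pow_add]; field_simp
      have e2 : qShiftedFactorial (a * p) p (r + m) * qShiftedFactorial (a * p ^ (r + m + 1)) p r =
          qShiftedFactorial (a * p) p (r + r) *
            qShiftedFactorial (a * p * p ^ (r + r)) p m := by
        rw [← qShiftedFactorial_add, show a * p ^ (r + m + 1) = a * p * p ^ (r + m) by ring,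
          ← qShiftedFactorial_add]
        congr 1; ring
      have e3 : qShiftedFactorial p p (r + m) =
          qShiftedFactorial p p m * qShiftedFactorial (p * p ^ m) p r := by
        rw [← qShiftedFactorial_add, add_comm]
      have e4 := qShiftedFactorial_inv_pow_mul p hp r m
      have hne : qShiftedFactorial (p * p ^ m) p r ≠ 0 := by
        have := nP (r + m)
        rw [e3] at this
        exact right_ne_zero_of_mul this
      have hL : ∀ x y z w v u g : K, x / (y * z) * (w / v * (g * u) ^ r) =
          x * g ^ r * (w * u ^ r) / (y * (z * v)) := fun x y z w v u g => by
        rw [mul_pow]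
        simp only [div_eq_mul_inv, mul_inv]; ring
      rw [hL, e2, ← pow_mul, e4, e3, qShiftedFactorial_add d, qShiftedFactorial_add _ p r m, e1,
        pow_add _ r m]
      have := nP m
      have := nA0 (r + r)
      have := nA (r + r) m
      field_simp
    rw [Finset.sum_congr rfl fun m _ => term m, ← Finset.mul_sum, key]
    have e5 : qShiftedFactorial (a * p) p (r + r) * qShiftedFactorial (a * p * p ^ (r + r)) p M =
        qShiftedFactorial (a * p) p (r + M) * qShiftedFactorial (a * p ^ (r + M + 1)) p r := by
      rw [← qShiftedFactorial_add, show a * p ^ (r + M + 1) = a * p * p ^ (r + M) by ring,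
          ← qShiftedFactorial_add]
      congr 1; ring
    have n5 : qShiftedFactorial (a * p ^ (r + M + 1)) p r ≠ 0 := by
      rw [show a * p ^ (r + M + 1) = a * p * p ^ (r + M) by ring]; exact nA _ _
    rw [qShiftedFactorial_add (a * p / d)]
    rw [div_mul_div_comm, e5]
    have := nA0 (r + M)
    have := nC0 r
    field_simp
  · intro n hn
    rw [qShiftedFactorial_inv_pow_eq_zero hp (Finset.mem_range.1 hn)]
    simp

/-- A limiting case of Watson's transformation of a terminating very-well-poised `₈φ₇` series, with
two of its parameters specialised to `√a` and `√(a p)`; here `p = h ^ 2` and `a = α ^ 2`. -/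
theorem watson_transformation (h α d : K) (hh : h ≠ 0) (hd : d ≠ 0)
    (hpj : ∀ j : ℕ, 1 - h * h ^ j ≠ 0)
    (hyj : ∀ j : ℕ, 1 - α ^ 2 * h * h ^ j ≠ 0)
    (hαj : ∀ j : ℕ, 1 - α * h * h ^ j ≠ 0)
    (hα : 1 + α ≠ 0)
    (hc : ∀ j : ℕ, 1 - α ^ 2 * h ^ 2 / d * (h ^ 2) ^ j ≠ 0) (N : ℕ) :
    ∑ n ∈ Finset.range (N + 1),
      qShiftedFactorial h (h ^ 2) n * qShiftedFactorial d (h ^ 2) n *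
        qShiftedFactorial (((h ^ 2) ^ N)⁻¹) (h ^ 2) n /
        (qShiftedFactorial (h ^ 2) (h ^ 2) n * qShiftedFactorial (α * h) (h ^ 2) n *
          qShiftedFactorial (α * h ^ 2) (h ^ 2) n) * (α ^ 2 * (h ^ 2) ^ (N + 1) / d) ^ n =
    qShiftedFactorial (α ^ 2 * h ^ 2 / d) (h ^ 2) N / qShiftedFactorial (α ^ 2 * h ^ 2) (h ^ 2) N *
      ∑ r ∈ Finset.range (N + 1),
        (1 + α * (h ^ 2) ^ r) / (1 + α) *
          (qShiftedFactorial (α ^ 2) (h ^ 2) r * qShiftedFactorial d (h ^ 2) r *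
            qShiftedFactorial (((h ^ 2) ^ N)⁻¹) (h ^ 2) r /
          (qShiftedFactorial (h ^ 2) (h ^ 2) r * qShiftedFactorial (α ^ 2 * h ^ 2 / d) (h ^ 2) r *
            qShiftedFactorial (α ^ 2 * (h ^ 2) ^ (N + 1)) (h ^ 2) r)) *
          ((-1) ^ r * h ^ (r ^ 2) * (α ^ 2 * (h ^ 2) ^ (N + 1) / d) ^ r) := by
  have hp : h ^ 2 ≠ 0 := pow_ne_zero _ hh
  have hp2 : ∀ j : ℕ, 1 - h ^ 2 * (h ^ 2) ^ j ≠ 0 := fun j => by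
    rw [show h ^ 2 * (h ^ 2) ^ j = h * h ^ (2 * j + 1) by ring]; exact hpj _
  have hy2 : ∀ j : ℕ, 1 - α ^ 2 * h ^ 2 * (h ^ 2) ^ j ≠ 0 := fun j => by
    rw [show α ^ 2 * h ^ 2 * (h ^ 2) ^ j = α ^ 2 * h * h ^ (2 * j + 1) by ring]; exact hyj _
  have nA : ∀ k, qShiftedFactorial (α ^ 2 * h ^ 2) (h ^ 2) k ≠ 0 := fun k =>
    qShiftedFactorial_ne_zero fun j _ => hy2 j
  set F : ℕ → ℕ → K := fun r n =>
    (1 + α * (h ^ 2) ^ r) / (1 + α) * (qShiftedFactorial (α ^ 2) (h ^ 2) r /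
      qShiftedFactorial (h ^ 2) (h ^ 2) r) *
    (qShiftedFactorial d (h ^ 2) n * qShiftedFactorial (((h ^ 2) ^ N)⁻¹) (h ^ 2) n *
        (α ^ 2 * (h ^ 2) ^ (N + 1) / d) ^ n /
      (qShiftedFactorial (h ^ 2) (h ^ 2) n * qShiftedFactorial (α ^ 2 * h ^ 2) (h ^ 2) n) *
        (qShiftedFactorial (((h ^ 2) ^ n)⁻¹) (h ^ 2) r /
          qShiftedFactorial (α ^ 2 * (h ^ 2) ^ (n + 1)) (h ^ 2) r *
          (h * (h ^ 2) ^ n) ^ r)) with hF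
  -- Each left term is expanded by `bailey_pair_sum` read backwards; since `(p^{-n}; p)_r = 0` for
  -- `r > n`, the inner range can be extended to `N`, which allows the interchange of sums.
  have left : ∀ n ∈ Finset.range (N + 1),
      qShiftedFactorial h (h ^ 2) n * qShiftedFactorial d (h ^ 2) n *
        qShiftedFactorial (((h ^ 2) ^ N)⁻¹) (h ^ 2) n /
        (qShiftedFactorial (h ^ 2) (h ^ 2) n * qShiftedFactorial (α * h) (h ^ 2) n *
          qShiftedFactorial (α * h ^ 2) (h ^ 2) n) * (α ^ 2 * (h ^ 2) ^ (N + 1) / d) ^ n =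
      ∑ r ∈ Finset.range (N + 1), F r n := by
    intro n hn
    have hn' : n + 1 ≤ N + 1 := Finset.mem_range.1 hn
    rw [← Finset.sum_subset (Finset.range_subset_range.2 hn')]
    · have key := bailey_pair_sum h α hh hpj hyj hαj hα n
      have : ∀ r ∈ Finset.range (n + 1), F r n =
          qShiftedFactorial d (h ^ 2) n * qShiftedFactorial (((h ^ 2) ^ N)⁻¹) (h ^ 2) n *
        (α ^ 2 * (h ^ 2) ^ (N + 1) / d) ^ n /
      (qShiftedFactorial (h ^ 2) (h ^ 2) n * qShiftedFactorial (α ^ 2 * h ^ 2) (h ^ 2) n) *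
        ((1 + α * (h ^ 2) ^ r) / (1 + α) *
          (qShiftedFactorial (α ^ 2) (h ^ 2) r * qShiftedFactorial (((h ^ 2) ^ n)⁻¹) (h ^ 2) r /
          (qShiftedFactorial (h ^ 2) (h ^ 2) r *
            qShiftedFactorial (α ^ 2 * (h ^ 2) ^ (n + 1)) (h ^ 2) r)) *
            (h * (h ^ 2) ^ n) ^ r) := fun r _ => by
        simp only [hF, div_eq_mul_inv, mul_inv]; ring
      rw [Finset.sum_congr rfl this, ← Finset.mul_sum, key]
      have := nA n
      generalize qShiftedFactorial (α ^ 2 * h ^ 2) (h ^ 2) n = x at *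
      simp only [div_eq_mul_inv, mul_inv]
      field_simp
    · intro r _ hr
      have : n < r := by simpa [Nat.lt_succ_iff] using hr
      simp [hF, qShiftedFactorial_inv_pow_eq_zero hp this]
  rw [Finset.sum_congr rfl left, Finset.sum_comm, Finset.mul_sum]
  refine Finset.sum_congr rfl fun r hr => ?_
  rw [hF, ← Finset.mul_sum, watson_inner_sum (h ^ 2) (α ^ 2) d h hp hd hp2 hy2 hc N r
    (Nat.lt_succ_iff.1 (Finset.mem_range.1 hr))]
  have e : h ^ r * (h ^ 2) ^ (r * (r - 1) / 2) = h ^ (r ^ 2) := by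
    rw [← pow_mul, Nat.mul_div_cancel' (Nat.even_mul_pred_self r).two_dvd, ← pow_add]
    congr 1
    cases r with
    | zero => rfl
    | succ r => simp; ring
  rw [← e]
  simp only [div_eq_mul_inv, mul_inv]; ring

end QSeries

/-! ### The deformed series as a polynomial in `x + x⁻¹`, and its vanishing when `ω^n = -1`. -/

section WellPoised

/-- The polynomial in `y = x + x⁻¹` that equals `(1 - u x) (1 - u x⁻¹)`. -/
noncomputable def wellPoisedFactor {S : Type*} [CommRing S] (u : S) : S[X] :=
  C (1 + u ^ 2) - C u * X

/-- The series `∑ k ≤ N, c k ∏_{j < k} (1 - u j x) (1 - u j x⁻¹) / ((1 - v j x) (1 - v j x⁻¹))`, as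
a polynomial in `y = x + x⁻¹` after multiplication by its common denominator. -/
noncomputable def clearedSeries {S : Type*} [CommRing S] (u v c : ℕ → S) (N : ℕ) : S[X] :=
  ∑ k ∈ Finset.range (N + 1), C (c k) * ((∏ j ∈ Finset.range k, wellPoisedFactor (u j)) *
    ∏ j ∈ Finset.Ico k N, wellPoisedFactor (v j))

theorem wellPoisedFactor_map {S T : Type*} [CommRing S] [CommRing T] (f : S →+* T) (u : S) :
    (wellPoisedFactor u).map f = wellPoisedFactor (f u) := by
  simp [wellPoisedFactor]

theorem clearedSeries_map {S T : Type*} [CommRing S] [CommRing T] (f : S →+* T)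
    (u v c : ℕ → S) (N : ℕ) :
    (clearedSeries u v c N).map f =
      clearedSeries (fun j => f (u j)) (fun j => f (v j)) (fun k => f (c k)) N := by
  simp [clearedSeries, Polynomial.map_sum, Polynomial.map_prod, wellPoisedFactor_map]

variable {K : Type*} [Field K]

theorem wellPoisedFactor_eval (u : K) {x : K} (hx : x ≠ 0) :
    (wellPoisedFactor u).eval (x + x⁻¹) = (1 - u * x) * (1 - u * x⁻¹) := by
  simp [wellPoisedFactor]
  field_simp
  ring

theorem prod_wellPoisedFactor_eval (a p : K) {x : K} (hx : x ≠ 0) (u : ℕ → K)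
    (hu : ∀ j, u j = a * p ^ j) (k : ℕ) :
    (∏ j ∈ Finset.range k, wellPoisedFactor (u j)).eval (x + x⁻¹) =
      qShiftedFactorial (a * x) p k * qShiftedFactorial (a * x⁻¹) p k := by
  rw [eval_prod, qShiftedFactorial, qShiftedFactorial, ← Finset.prod_mul_distrib]
  refine Finset.prod_congr rfl fun j _ => ?_
  rw [wellPoisedFactor_eval _ hx, hu]
  ring

theorem clearedSeries_eval (a b p : K) {x : K} (hx : x ≠ 0) (u v c : ℕ → K)
    (hu : ∀ j, u j = a * p ^ j) (hv : ∀ j, v j = b * p ^ j) (N : ℕ)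
    (h1 : qShiftedFactorial (b * x) p N ≠ 0) (h2 : qShiftedFactorial (b * x⁻¹) p N ≠ 0) :
    (clearedSeries u v c N).eval (x + x⁻¹) =
      qShiftedFactorial (b * x) p N * qShiftedFactorial (b * x⁻¹) p N *
        ∑ k ∈ Finset.range (N + 1), c k *
          (qShiftedFactorial (a * x) p k * qShiftedFactorial (a * x⁻¹) p k /
            (qShiftedFactorial (b * x) p k * qShiftedFactorial (b * x⁻¹) p k)) := by
  rw [clearedSeries, eval_finsetSum, Finset.mul_sum]
  refine Finset.sum_congr rfl fun k hk => ?_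
  have hk' : k ≤ N := Nat.lt_succ_iff.1 (Finset.mem_range.1 hk)
  have e := Finset.prod_range_mul_prod_Ico (fun j => wellPoisedFactor (v j)) hk'
  have e' := congrArg (eval (x + x⁻¹)) e
  rw [eval_mul, prod_wellPoisedFactor_eval b p hx v hv, prod_wellPoisedFactor_eval b p hx v hv]
    at e'
  rw [eval_mul, eval_C, eval_mul, prod_wellPoisedFactor_eval a p hx u hu, ← e']
  obtain ⟨m, rfl⟩ := Nat.exists_eq_add_of_le hk'
  rw [qShiftedFactorial_add] at h1 h2
  have n1 := left_ne_zero_of_mul h1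
  have n2 := left_ne_zero_of_mul h2
  generalize eval (x + x⁻¹) (∏ j ∈ Finset.Ico k (k + m), wellPoisedFactor (v j)) = P
  generalize qShiftedFactorial (b * x) p k = A at *
  generalize qShiftedFactorial (b * x⁻¹) p k = B at *
  field_simp

theorem wellPoisedFactor_inv {u : K} (hu : u ≠ 0) :
    wellPoisedFactor u⁻¹ = C ((u ^ 2)⁻¹) * wellPoisedFactor u := by
  rw [wellPoisedFactor, wellPoisedFactor, mul_sub, ← mul_assoc, ← C_mul, ← C_mul]
  congr 2
  · field_simp; ring
  · field_simp

/-- With `N = k + m`, the hypothesis gives `ω^{2s} = ω^{-8N}`, so the quotient of shifted factorials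
is a signed Gaussian binomial up to a power of `ω`. The right side is symmetric in `k` and `m`
except for `ω^{-4k} + ω^{4k+s}`. The last power on the left is the constant released in
`clearedSeries_eq_zero` when the numerator factors are inverted. -/
theorem wellPoised_coefficient (ω : K) (hω : ω ≠ 0) (s : ℤ) (k m : ℕ)
    (hn : ω ^ (4 * ((k : ℤ) + m) + s) = -1)
    (hpj : ∀ j < k + m, 1 - ω ^ 8 * (ω ^ 8) ^ j ≠ 0) :
    (-1) ^ k * ((1 + ω ^ (8 * (k : ℤ) + s)) * qShiftedFactorial (ω ^ (2 * s)) (ω ^ 8) k /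
        ((1 + ω ^ s) * qShiftedFactorial (ω ^ 8) (ω ^ 8) k)) *
        ω ^ (4 * (k : ℤ) ^ 2 + 2 * (k : ℤ) * (4 - s)) *
        ω ^ (8 * (k : ℤ) * (k - 1) - 16 * (k + m) * k) =
      qShiftedFactorial (ω ^ 8) (ω ^ 8) (k + m) / (1 + ω ^ s) *
        ((ω ^ (-4 * (k : ℤ)) + ω ^ (4 * (k : ℤ) + s)) * ω ^ (-16 * (k : ℤ) * m) /
        (qShiftedFactorial (ω ^ 8) (ω ^ 8) k * qShiftedFactorial (ω ^ 8) (ω ^ 8) m)) := by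
  have nP : ∀ i ≤ k + m, qShiftedFactorial (ω ^ 8) (ω ^ 8) i ≠ 0 := fun i hi =>
    qShiftedFactorial_ne_zero fun j hj => hpj j (by omega)
  have z8 : ∀ i : ℕ, (ω ^ 8) ^ i = ω ^ (8 * (i : ℤ)) := fun i => by
    rw [← pow_mul, ← zpow_natCast]; push_cast; rfl
  have e1 : ω ^ (2 * s) = ((ω ^ 8) ^ (k + m))⁻¹ := by
    apply eq_inv_of_mul_eq_one_left
    rw [z8, ← zpow_add₀ hω,
      show 2 * s + 8 * ((k + m : ℕ) : ℤ) = (4 * ((k : ℤ) + m) + s) * 2 by push_cast; ring,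
      zpow_mul, hn]
    norm_num
  have e2 := qShiftedFactorial_inv_pow_mul (ω ^ 8) (pow_ne_zero _ hω) k m
  have e3 : qShiftedFactorial (ω ^ 8) (ω ^ 8) (k + m) = qShiftedFactorial (ω ^ 8) (ω ^ 8) m *
      qShiftedFactorial (ω ^ 8 * (ω ^ 8) ^ m) (ω ^ 8) k := by
    rw [add_comm, qShiftedFactorial_add]
  have e4 : qShiftedFactorial (ω ^ (2 * s)) (ω ^ 8) k =
      (-1) ^ k * ω ^ (4 * (k : ℤ) * (k - 1) - 8 * (k + m) * k) *
        (qShiftedFactorial (ω ^ 8) (ω ^ 8) (k + m) / qShiftedFactorial (ω ^ 8) (ω ^ 8) m) := by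
    have c := Nat.div_mul_cancel (Nat.even_mul_pred_self k).two_dvd
    generalize k * (k - 1) / 2 = w at *
    have c' : (w : ℤ) * 2 = k * (k - 1) := by
      cases k with
      | zero => simpa using c
      | succ k => push_cast; rw [add_sub_cancel_right]; exact_mod_cast c
    have hm := nP m (by omega)
    rw [← e1, z8, z8] at e2
    rw [e3, mul_div_cancel_left₀ _ hm]
    have h8 : ω ^ (8 * (((k + m) * k : ℕ) : ℤ)) ≠ 0 := zpow_ne_zero _ hω
    apply mul_right_cancel₀ h8
    rw [e2, show 8 * (w : ℤ) = (4 * (k : ℤ) * (k - 1) - 8 * (k + m) * k) +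
      8 * (((k + m) * k : ℕ) : ℤ) by push_cast; linarith, zpow_add₀ hω]
    ring
  have nk := nP k (by omega)
  have nm := nP m (by omega)
  have nN := nP (k + m) le_rfl
  have sq : ((-1 : K) ^ k) * (-1) ^ k = 1 := by rw [← mul_pow]; simp
  have pw : (1 + ω ^ (8 * (k : ℤ) + s)) * (ω ^ (4 * (k : ℤ) * (k - 1) - 8 * (k + m) * k) *
      ω ^ (4 * (k : ℤ) ^ 2 + 2 * (k : ℤ) * (4 - s)) *
        ω ^ (8 * (k : ℤ) * (k - 1) - 16 * (k + m) * k)) =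
      (ω ^ (-4 * (k : ℤ)) + ω ^ (4 * (k : ℤ) + s)) * ω ^ (-16 * (k : ℤ) * m) := by
    -- The total exponent contains `-2k (4N + s)`, which contributes `(-1)^{-2k} = 1`.
    have h1 : ω ^ ((4 * ((k : ℤ) + m) + s) * (-2 * k)) = 1 := by
      rw [zpow_mul, hn, zpow_mul]; norm_num
    rw [← zpow_add₀ hω, ← zpow_add₀ hω]
    have hT : (4 * (k : ℤ) * (k - 1) - 8 * (k + m) * k) + (4 * (k : ℤ) ^ 2 + 2 * (k : ℤ) * (4 - s))
      + (8 * (k : ℤ) * (k - 1) - 16 * (k + m) * k) =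
      (4 * ((k : ℤ) + m) + s) * (-2 * k) + (-4 * k) + (-16 * (k : ℤ) * m) := by ring
    rw [hT, zpow_add₀ hω _ (-16 * (k : ℤ) * m), zpow_add₀ hω _ (-4 * (k : ℤ)), h1, one_mul, ← mul_assoc, add_mul, one_mul,
      ← zpow_add₀ hω, show 8 * (k : ℤ) + s + -4 * k = 4 * k + s by ring]
  rw [e4]
  generalize qShiftedFactorial (ω ^ 8) (ω ^ 8) (k + m) = A at *
  rw [← pw]
  simp only [div_eq_mul_inv, mul_inv]
  linear_combination ((1 + ω ^ (8 * (k : ℤ) + s)) * (ω ^ (4 * (k : ℤ) * (k - 1) - 8 * (k + m) * k) *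
      ω ^ (4 * (k : ℤ) ^ 2 + 2 * (k : ℤ) * (4 - s)) *
        ω ^ (8 * (k : ℤ) * (k - 1) - 16 * (k + m) * k)) * A * (1 + ω ^ s)⁻¹ *
        (qShiftedFactorial (ω ^ 8) (ω ^ 8) k)⁻¹ * (qShiftedFactorial (ω ^ 8) (ω ^ 8) m)⁻¹) * sq

/-- Since `ω^{2s} = ω^{-8N}`, the numerator product is a constant times `G k`, and the leftover
denominator product read backwards is `G (N - k)`. So the `k`-th term is `g k m • G k G m` with `m =
N - k`. As `ω^{4k+s} = -ω^{-4m}`, the coefficient `g` is antisymmetric and the terms cancel in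
pairs. -/
theorem clearedSeries_eq_zero [CharZero K] (ω : K) (hω : ω ≠ 0) (s : ℤ) (N : ℕ)
    (hn : ω ^ (4 * (N : ℤ) + s) = -1)
    (hpj : ∀ j < N, 1 - ω ^ 8 * (ω ^ 8) ^ j ≠ 0) :
    clearedSeries (fun j => ω ^ (2 * s + 8 * (j : ℤ))) (fun j => ω ^ (8 + 8 * (j : ℤ)))
      (fun k => (-1) ^ k * ((1 + ω ^ (8 * (k : ℤ) + s)) *
        qShiftedFactorial (ω ^ (2 * s)) (ω ^ 8) k /
        ((1 + ω ^ s) * qShiftedFactorial (ω ^ 8) (ω ^ 8) k)) *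
        ω ^ (4 * (k : ℤ) ^ 2 + 2 * (k : ℤ) * (4 - s))) N = 0 := by
  set G : ℕ → K[X] := fun k =>
    ∏ j ∈ Finset.range k, wellPoisedFactor (ω ^ (8 * ((N : ℤ) - j))) with hG
  set g : ℕ → ℕ → K := fun k m => qShiftedFactorial (ω ^ 8) (ω ^ 8) (k + m) / (1 + ω ^ s) *
        ((ω ^ (-4 * (k : ℤ)) + ω ^ (4 * (k : ℤ) + s)) * ω ^ (-16 * (k : ℤ) * m) /
        (qShiftedFactorial (ω ^ 8) (ω ^ 8) k * qShiftedFactorial (ω ^ 8) (ω ^ 8) m)) with hg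
  have hu : ∀ k ≤ N, ∏ j ∈ Finset.range k, wellPoisedFactor (ω ^ (2 * s + 8 * (j : ℤ))) =
      C (ω ^ (8 * (k : ℤ) * (k - 1) - 16 * N * k)) * G k := by
    intro k hk
    induction k with
    | zero => simp [hG]
    | succ k ih =>
      have h1 : ω ^ (2 * s + 8 * (k : ℤ)) = (ω ^ (8 * ((N : ℤ) - k)))⁻¹ := by
        apply eq_inv_of_mul_eq_one_left
        rw [← zpow_add₀ hω,
          show 2 * s + 8 * (k : ℤ) + 8 * ((N : ℤ) - k) = (4 * (N : ℤ) + s) * 2 by ring,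
          zpow_mul, hn]
        norm_num
      have h2 : C (ω ^ (8 * ((k + 1 : ℕ) : ℤ) * ((k + 1 : ℕ) - 1) - 16 * N * (k + 1 : ℕ))) =
          C (ω ^ (8 * (k : ℤ) * (k - 1) - 16 * N * k)) *
            C (((ω ^ (8 * ((N : ℤ) - k))) ^ 2)⁻¹) := by
        rw [← C_mul, ← zpow_natCast (ω ^ (8 * ((N : ℤ) - k))), ← zpow_mul, ← zpow_neg,
          ← zpow_add₀ hω]
        congr 2; push_cast; ring
      rw [Finset.prod_range_succ, ih (by omega), h1, wellPoisedFactor_inv (zpow_ne_zero _ hω), h2]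
      simp only [hG]
      rw [Finset.prod_range_succ]
      ring
  have hv : ∀ k m : ℕ, k + m = N →
      ∏ j ∈ Finset.Ico k N, wellPoisedFactor (ω ^ (8 + 8 * (j : ℤ))) = G m := by
    intro k m hkm
    rw [Finset.prod_Ico_eq_prod_range, show N - k = m by omega, hG, ← Finset.prod_range_reflect]
    refine Finset.prod_congr rfl fun i hi => ?_
    have hi' := Finset.mem_range.1 hi
    congr 2
    omega
  have ht : ∀ k m : ℕ, k + m = N → ∀ P : K,
      P * ω ^ (8 * (k : ℤ) * (k - 1) - 16 * N * k) = g k m →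
      C P * ((∏ j ∈ Finset.range k, wellPoisedFactor (ω ^ (2 * s + 8 * (j : ℤ)))) *
        ∏ j ∈ Finset.Ico k N, wellPoisedFactor (ω ^ (8 + 8 * (j : ℤ)))) =
      C (g k m) * (G k * G m) := by
    intro k m hkm P hP
    rw [hu k (by omega), hv k m hkm, ← hP, C_mul]
    ring
  have hanti : ∀ k m : ℕ, k + m = N → g m k = - g k m := by
    intro k m hkm
    have hk : (k : ℤ) = N - m := by omega
    have h1 : ω ^ (-4 * (m : ℤ)) + ω ^ (4 * (m : ℤ) + s) =
        -(ω ^ (-4 * (k : ℤ)) + ω ^ (4 * (k : ℤ) + s)) := by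
      have h2 : ω ^ (4 * (k : ℤ) + s) = - ω ^ (-4 * (m : ℤ)) := by
        rw [show 4 * (k : ℤ) + s = (4 * (N : ℤ) + s) + (-4 * (m : ℤ)) by rw [hk]; ring,
          zpow_add₀ hω, hn, neg_one_mul]
      have h3 : ω ^ (4 * (m : ℤ) + s) = - ω ^ (-4 * (k : ℤ)) := by
        rw [show 4 * (m : ℤ) + s = (4 * (N : ℤ) + s) + (-4 * (k : ℤ)) by rw [hk]; ring,
          zpow_add₀ hω, hn, neg_one_mul]
      rw [h2, h3]; ring
    simp only [hg]
    rw [h1, add_comm m k, show -16 * (m : ℤ) * k = -16 * (k : ℤ) * m by ring]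
    ring
  have hterm : ∀ k ∈ Finset.range (N + 1), C ((-1) ^ k * ((1 + ω ^ (8 * (k : ℤ) + s)) *
        qShiftedFactorial (ω ^ (2 * s)) (ω ^ 8) k /
        ((1 + ω ^ s) * qShiftedFactorial (ω ^ 8) (ω ^ 8) k)) *
        ω ^ (4 * (k : ℤ) ^ 2 + 2 * (k : ℤ) * (4 - s))) *
      ((∏ j ∈ Finset.range k, wellPoisedFactor (ω ^ (2 * s + 8 * (j : ℤ)))) *
        ∏ j ∈ Finset.Ico k N, wellPoisedFactor (ω ^ (8 + 8 * (j : ℤ)))) =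
      C (g k (N - k)) * (G k * G (N - k)) := by
    intro k hk
    obtain ⟨m, rfl⟩ := Nat.exists_eq_add_of_le (Nat.lt_succ_iff.1 (Finset.mem_range.1 hk))
    rw [Nat.add_sub_cancel_left]
    apply ht k m rfl
    rw [Nat.cast_add] at hn ⊢
    exact wellPoised_coefficient ω hω s k m hn hpj
  rw [clearedSeries, Finset.sum_congr rfl hterm]
  -- In characteristic zero it suffices that the sum equals its own negative, which is seen by
  -- reflecting `k ↦ N - k`; this also covers a middle term.
  rw [← self_eq_neg, ← Finset.sum_neg_distrib]
  conv_lhs => rw [← Finset.sum_range_reflect]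
  refine Finset.sum_congr rfl fun k hk => ?_
  obtain ⟨m, hm⟩ := Nat.exists_eq_add_of_le (Nat.lt_succ_iff.1 (Finset.mem_range.1 hk))
  rw [show N + 1 - 1 - k = m by omega, show N - m = k by omega, show N - k = m by omega,
    hanti k m hm.symm, C_neg]
  ring

end WellPoised

/-! ### Watson's transformation at `x = q^{2n}`. -/

section WatsonSpecial

variable {K : Type*} [Field K]

theorem qShiftedFactorial_reverse (q : K) (hq : q ≠ 0) (s : ℤ) (N : ℕ) :
    qShiftedFactorial (q ^ (8 - 2 * s - 8 * (N : ℤ))) (q ^ 8) N * q ^ ((N : ℤ) * (4 * N + 2 * s - 4)) =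
      (-1) ^ N * qShiftedFactorial (q ^ (2 * s)) (q ^ 8) N := by
  have z8 : ∀ i : ℕ, (q ^ 8) ^ i = q ^ (8 * (i : ℤ)) := fun i => by
    rw [← pow_mul, ← zpow_natCast]; push_cast; rfl
  induction N with
  | zero => simp [qShiftedFactorial_zero]
  | succ N ih =>
    have e1 : q ^ (8 - 2 * s - 8 * ((N + 1 : ℕ) : ℤ)) * q ^ 8 = q ^ (8 - 2 * s - 8 * (N : ℤ)) := by
      rw [← zpow_natCast q 8, ← zpow_add₀ hq]; congr 1; push_cast; ring
    have e2 : q ^ (((N + 1 : ℕ) : ℤ) * (4 * (N + 1 : ℕ) + 2 * s - 4)) =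
        q ^ ((N : ℤ) * (4 * N + 2 * s - 4)) * q ^ (2 * s + 8 * (N : ℤ)) := by
      rw [← zpow_add₀ hq]; congr 1; push_cast; ring
    have e3 : q ^ (8 - 2 * s - 8 * ((N + 1 : ℕ) : ℤ)) * q ^ (2 * s + 8 * (N : ℤ)) = 1 := by
      rw [← zpow_add₀ hq, ← zpow_zero q]; congr 1; push_cast; ring
    rw [qShiftedFactorial_succ_left, e1, qShiftedFactorial_succ, z8, ← zpow_add₀ hq, e2, pow_succ (-1 : K) N]
    linear_combination (q ^ (2 * s + 8 * (N : ℤ)) - 1) * ih -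
      qShiftedFactorial (q ^ (8 - 2 * s - 8 * (N : ℤ))) (q ^ 8) N *
        q ^ ((N : ℤ) * (4 * N + 2 * s - 4)) * e3

/-- This is `watson_transformation` with `h = q^4`, `α = q^s`, `d = q^{2s} x`. The choice of `x`
makes `q^{2s} x⁻¹ = (q^8)^{-N}`, the terminating parameter. The two sides appear exchanged, so the
prefactor here is the inverse of Watson's (`hpref`). -/
theorem watson_specialised (q : K) (hq : q ≠ 0) (hq1 : ∀ m : ℤ, q ^ m = 1 → m = 0)
    (s : ℤ) (hs : s = 1 ∨ s = -1) (N : ℕ) (x : K) (hx : x = q ^ (8 * (N : ℤ) + 2 * s)) :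
    ∑ k ∈ Finset.range (N + 1),
      (-1) ^ k * ((1 + q ^ (8 * (k : ℤ) + s)) * qShiftedFactorial (q ^ (2 * s)) (q ^ 8) k /
        ((1 + q ^ s) * qShiftedFactorial (q ^ 8) (q ^ 8) k)) *
        q ^ (4 * (k : ℤ) ^ 2 + 2 * (k : ℤ) * (4 - s)) *
        (qShiftedFactorial (q ^ (2 * s) * x) (q ^ 8) k *
          qShiftedFactorial (q ^ (2 * s) * x⁻¹) (q ^ 8) k /
          (qShiftedFactorial (q ^ 8 * x) (q ^ 8) k * qShiftedFactorial (q ^ 8 * x⁻¹) (q ^ 8) k)) =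
    (-1) ^ N * ((1 - q ^ (8 * (N : ℤ) + 2 * s)) / (1 - q ^ (2 * s))) *
      q ^ ((N : ℤ) * (4 * N + 2 * s - 4)) *
      ∑ k ∈ Finset.range (N + 1),
        qShiftedFactorial (q ^ (2 * s) * x) (q ^ 8) k *
          qShiftedFactorial (q ^ (2 * s) * x⁻¹) (q ^ 8) k * qShiftedFactorial (q ^ 4) (q ^ 8) k /
          (qShiftedFactorial (q ^ 8) (q ^ 8) k * qShiftedFactorial (q ^ (4 + s)) (q ^ 8) k *
            qShiftedFactorial (q ^ (8 + s)) (q ^ 8) k) * q ^ (2 * (k : ℤ) * (4 - s)) := by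
  have z8 : ∀ i : ℕ, (q ^ 8) ^ i = q ^ (8 * (i : ℤ)) := fun i => by
    rw [← pow_mul, ← zpow_natCast]; push_cast; rfl
  have z4 : ∀ i : ℕ, (q ^ 4) ^ i = q ^ (4 * (i : ℤ)) := fun i => by
    rw [← pow_mul, ← zpow_natCast]; push_cast; rfl
  have p4 : q ^ 4 = q ^ (4 : ℤ) := (zpow_natCast q 4).symm
  have p8 : q ^ 8 = q ^ (8 : ℤ) := (zpow_natCast q 8).symm
  have p42 : (q ^ 4) ^ 2 = q ^ 8 := by ring
  have s2 : (q ^ s) ^ 2 = q ^ (2 * s) := by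
    rw [← zpow_natCast, ← zpow_mul]; congr 1; push_cast; ring
  have ne1 : ∀ m : ℤ, m ≠ 0 → 1 - q ^ m ≠ 0 := fun m hm h =>
    hm (hq1 m (sub_eq_zero.1 h).symm)
  have hd : (q ^ (4 * s + 8 * (N : ℤ)) : K) ≠ 0 := zpow_ne_zero _ hq
  have hα : 1 + q ^ s ≠ 0 := fun h => by
    have h1 : q ^ s = -1 := by linear_combination h
    have := hq1 (2 * s) (by rw [← s2, h1]; norm_num)
    omega
  have apd : q ^ (2 * s) * q ^ 8 / q ^ (4 * s + 8 * (N : ℤ)) = q ^ (8 - 2 * s - 8 * (N : ℤ)) := by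
    rw [p8, ← zpow_add₀ hq, ← zpow_sub₀ hq]; congr 1; ring
  have key := watson_transformation (q ^ 4) (q ^ s) (q ^ (4 * s + 8 * (N : ℤ)))
    (pow_ne_zero _ hq) hd
    (fun j => by
      rw [z4, p4, ← zpow_add₀ hq]; exact ne1 _ (by omega))
    (fun j => by
      rw [z4, p4, s2, ← zpow_add₀ hq, ← zpow_add₀ hq]; exact ne1 _ (by omega))
    (fun j => by
      rw [z4, p4, ← zpow_add₀ hq, ← zpow_add₀ hq]; exact ne1 _ (by omega))
    hα
    (fun j => by
      rw [p42, s2, apd, z8, ← zpow_add₀ hq]; exact ne1 _ (by omega)) N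
  have ex : q ^ (4 * s + 8 * (N : ℤ)) = q ^ (2 * s) * x := by
    rw [hx, ← zpow_add₀ hq]; congr 1; ring
  have ex' : ((q ^ 8) ^ N)⁻¹ = q ^ (2 * s) * x⁻¹ := by
    rw [hx, z8, ← zpow_neg, ← zpow_neg, ← zpow_add₀ hq]; congr 1; ring
  have ez : q ^ (2 * s) * (q ^ 8) ^ (N + 1) / q ^ (4 * s + 8 * (N : ℤ)) = q ^ (2 * (4 - s)) := by
    rw [z8, ← zpow_add₀ hq, ← zpow_sub₀ hq]; congr 1; push_cast; ring
  have ed : q ^ (2 * s) * (q ^ 8) ^ (N + 1) = q ^ 8 * x := by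
    rw [hx, z8, p8, ← zpow_add₀ hq, ← zpow_add₀ hq]; congr 1; push_cast; ring
  have ed' : q ^ (2 * s) * q ^ 8 / q ^ (4 * s + 8 * (N : ℤ)) = q ^ 8 * x⁻¹ := by
    rw [apd, hx, p8, ← zpow_neg, ← zpow_add₀ hq]; congr 1; ring
  have e4 : q ^ s * q ^ 4 = q ^ (4 + s) := by rw [p4, ← zpow_add₀ hq, add_comm]
  have e8 : q ^ s * q ^ 8 = q ^ (8 + s) := by rw [p8, ← zpow_add₀ hq, add_comm]
  have ezk : ∀ k : ℕ, (q ^ (2 * (4 - s))) ^ k = q ^ (2 * (k : ℤ) * (4 - s)) := fun k => by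
    rw [← zpow_natCast, ← zpow_mul]; congr 1; ring
  have ehk : ∀ k : ℕ, (q ^ 4) ^ (k ^ 2) * q ^ (2 * (k : ℤ) * (4 - s)) =
      q ^ (4 * (k : ℤ) ^ 2 + 2 * (k : ℤ) * (4 - s)) := fun k => by
    rw [z4, ← zpow_add₀ hq]; push_cast; rfl
  have eas : ∀ k : ℕ, q ^ s * (q ^ 8) ^ k = q ^ (8 * (k : ℤ) + s) := fun k => by
    rw [z8, ← zpow_add₀ hq, add_comm]
  simp only [p42, s2] at key
  rw [ez, ed, ed', ex'] at key
  simp only [ex, e4, e8, ezk, eas] at key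
  have hrev := qShiftedFactorial_reverse q hq s N
  have hpre : (1 - q ^ (2 * s)) * qShiftedFactorial (q ^ (2 * s) * q ^ 8) (q ^ 8) N =
      qShiftedFactorial (q ^ (2 * s)) (q ^ 8) N * (1 - q ^ (8 * (N : ℤ) + 2 * s)) := by
    rw [← qShiftedFactorial_succ_left, qShiftedFactorial_succ, z8, ← zpow_add₀ hq,
      add_comm (2 * s)]
  rw [← apd, ed'] at hrev
  have nA : qShiftedFactorial (q ^ (2 * s)) (q ^ 8) N ≠ 0 :=
    qShiftedFactorial_ne_zero fun j _ => by
      rw [z8, ← zpow_add₀ hq]; exact ne1 _ (by omega)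
  have nAp : qShiftedFactorial (q ^ (2 * s) * q ^ 8) (q ^ 8) N ≠ 0 :=
    qShiftedFactorial_ne_zero fun j _ => by
      rw [z8, p8, ← zpow_add₀ hq, ← zpow_add₀ hq]; exact ne1 _ (by omega)
  have n2s : 1 - q ^ (2 * s) ≠ 0 := ne1 _ (by omega)
  have sq : ((-1 : K) ^ N) * (-1) ^ N = 1 := by rw [← mul_pow]; simp
  have hpref : (-1) ^ N * ((1 - q ^ (8 * (N : ℤ) + 2 * s)) / (1 - q ^ (2 * s))) *
      q ^ ((N : ℤ) * (4 * N + 2 * s - 4)) * (qShiftedFactorial (q ^ 8 * x⁻¹) (q ^ 8) N /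
        qShiftedFactorial (q ^ (2 * s) * q ^ 8) (q ^ 8) N) = 1 := by
    have h1 : (1 - q ^ (8 * (N : ℤ) + 2 * s)) / (1 - q ^ (2 * s)) =
        qShiftedFactorial (q ^ (2 * s) * q ^ 8) (q ^ 8) N /
          qShiftedFactorial (q ^ (2 * s)) (q ^ 8) N := by
      rw [div_eq_div_iff n2s nA]; linear_combination -hpre
    have h2 : qShiftedFactorial (q ^ 8 * x⁻¹) (q ^ 8) N = (-1) ^ N *
        qShiftedFactorial (q ^ (2 * s)) (q ^ 8) N / q ^ ((N : ℤ) * (4 * N + 2 * s - 4)) := by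
      rw [eq_div_iff (zpow_ne_zero _ hq), hrev]
    rw [h1, h2]
    have := zpow_ne_zero ((N : ℤ) * (4 * N + 2 * s - 4)) hq
    generalize q ^ ((N : ℤ) * (4 * N + 2 * s - 4)) = y at *
    generalize qShiftedFactorial (q ^ (2 * s) * q ^ 8) (q ^ 8) N = z at *
    generalize qShiftedFactorial (q ^ (2 * s)) (q ^ 8) N = w at *
    field_simp
    rw [pow_two, sq]
  have hR : ∀ S T : K, S = qShiftedFactorial (q ^ 8 * x⁻¹) (q ^ 8) N /
        qShiftedFactorial (q ^ (2 * s) * q ^ 8) (q ^ 8) N * T →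
      T = (-1) ^ N * ((1 - q ^ (8 * (N : ℤ) + 2 * s)) / (1 - q ^ (2 * s))) *
      q ^ ((N : ℤ) * (4 * N + 2 * s - 4)) * S := fun S T h => by
    rw [h]; linear_combination -T * hpref
  convert hR _ _ key using 2
  · rw [← ehk]
    simp only [div_eq_mul_inv, mul_inv]
    ring
  · refine Finset.sum_congr rfl fun k _ => ?_
    simp only [div_eq_mul_inv, mul_inv]
    ring

end WatsonSpecial

/-! ### The deformed difference over a ring with a residue field. -/

section LocalCongruence

variable {R K L : Type*} [CommRing R] [Field K] [Field L]

theorem map_units_zpow (f : R →+* K) (Q : Rˣ) (m : ℤ) :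
    f ((Q ^ m : Rˣ) : R) = f (Q : R) ^ m := by
  have := congrArg (Units.val) (map_zpow (Units.map (f : R →* K)) Q m)
  simpa only [Units.coe_map, Units.val_zpow_eq_zpow_val, MonoidHom.coe_coe] using this

theorem map_units_ne_zero (f : R →+* K) (Q : Rˣ) : f (Q : R) ≠ 0 :=
  (Q.isUnit.map f).ne_zero

/-- The `q`-shifted factorial `(q ^ e; q ^ 8)_k` for a unit `q` of a commutative ring. -/
def unitShiftedFactorial (Q : Rˣ) (e : ℤ) (k : ℕ) : R :=
  ∏ j ∈ Finset.range k, (1 - ((Q ^ (e + 8 * (j : ℤ)) : Rˣ) : R))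

theorem map_unitShiftedFactorial (f : R →+* K) (Q : Rˣ) (e : ℤ) (k : ℕ) :
    f (unitShiftedFactorial Q e k) = qShiftedFactorial (f (Q : R) ^ e) (f (Q : R) ^ 8) k := by
  rw [unitShiftedFactorial, qShiftedFactorial, map_prod]
  refine Finset.prod_congr rfl fun j _ => ?_
  rw [map_sub, map_one, map_units_zpow, zpow_add₀ (map_units_ne_zero f Q), ← pow_mul,
    ← zpow_natCast _ (8 * j)]
  push_cast
  rfl

theorem unitShiftedFactorial_mul (Q : Rˣ) (s : ℤ) (k : ℕ) :
    unitShiftedFactorial Q (4 + s) k * unitShiftedFactorial Q (8 + s) k =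
      ∏ i ∈ Finset.Ico 1 (2 * k + 1), (1 - ((Q ^ (4 * (i : ℤ) + s) : Rˣ) : R)) := by
  induction k with
  | zero => simp [unitShiftedFactorial]
  | succ k ih =>
    rw [show 2 * (k + 1) + 1 = 2 * k + 1 + 1 + 1 by ring, Finset.prod_Ico_succ_top (by omega),
      Finset.prod_Ico_succ_top (by omega), ← ih]
    simp only [unitShiftedFactorial, Finset.prod_range_succ]
    rw [show 4 * ((2 * k + 1 : ℕ) : ℤ) + s = 4 + s + 8 * (k : ℤ) by push_cast; ring,
      show 4 * ((2 * k + 1 + 1 : ℕ) : ℤ) + s = 8 + s + 8 * (k : ℤ) by push_cast; ring]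
    ring

/-- As `n` is odd, `n ∣ 8i` would force `n ∣ i`, but `0 < |i| ≤ N < n`. -/
theorem not_dvd_eight_mul {n N : ℕ} {s : ℤ} (hs : s = 1 ∨ s = -1)
    (hn : (n : ℤ) = 4 * N + s) {i : ℤ} (hi : i ≠ 0) (hiN : |i| ≤ N) : ¬ (n : ℤ) ∣ 8 * i := by
  intro h
  have hc : IsCoprime (n : ℤ) 8 := by
    rw [show (8 : ℤ) = 2 ^ 3 by norm_num]
    apply IsCoprime.pow_right
    rw [hn]
    rcases hs with rfl | rfl
    · exact ⟨1, -2 * N, by ring⟩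
    · exact ⟨-1, 2 * N, by ring⟩
  have h1 := hc.dvd_of_dvd_mul_left h
  have h2 := Int.le_of_dvd (abs_pos.2 hi) ((dvd_abs _ _).2 h1)
  omega

/-- The denominators interleave to `∏ (1 - q^{4i+s})` over `1 ≤ i ≤ 2k ≤ 2N`. Only `i = N` gives a
multiple of `n`, namely `n` itself; all other factors are units. Splitting `1 - q^{2n} = (1 - q^n)(1
+ q^n)` absorbs that factor, and `1 + q^n` survives in the quotient. -/
theorem exists_regular_quotient {n N : ℕ} {s : ℤ} (hs : s = 1 ∨ s = -1)
    (hn : (n : ℤ) = 4 * N + s) (ρ : R →+* L) (Q : Rˣ)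
    (hU : ∀ m : ℤ, ¬ (n : ℤ) ∣ m → IsUnit (1 - ((Q ^ m : Rˣ) : R))) {k : ℕ} (hk : k ≤ N) :
    ∃ e : R, e * (unitShiftedFactorial Q (4 + s) k * unitShiftedFactorial Q (8 + s) k) =
        1 - ((Q ^ (2 * (n : ℤ)) : Rˣ) : R) ∧
      (ρ (Q : R) ^ (n : ℤ) = -1 → ρ e = 0) := by
  rw [unitShiftedFactorial_mul]
  have hsplit : 1 - ((Q ^ (2 * (n : ℤ)) : Rˣ) : R) =
      (1 + ((Q ^ (n : ℤ) : Rˣ) : R)) * (1 - ((Q ^ (n : ℤ) : Rˣ) : R)) := by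
    rw [mul_comm, zpow_mul]
    simp only [zpow_natCast, Units.val_pow_eq_pow_val, zpow_ofNat]
    ring
  have hunit : ∀ i ∈ (Finset.Ico 1 (2 * k + 1)).erase N,
      IsUnit (1 - ((Q ^ (4 * (i : ℤ) + s) : Rˣ) : R)) := by
    intro i hi
    rw [Finset.mem_erase, Finset.mem_Ico] at hi
    apply hU
    intro h
    have h2 : (n : ℤ) ∣ 8 * ((i : ℤ) - N) := by
      have := dvd_sub h (dvd_refl (n : ℤ))
      rw [show 4 * (i : ℤ) + s - n = 4 * (i - N) by rw [hn]; ring] at this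
      rw [show 8 * ((i : ℤ) - N) = 4 * (i - N) * 2 by ring]
      exact this.mul_right 2
    refine not_dvd_eight_mul hs hn (by omega) ?_ h2
    rw [abs_le]; constructor <;> omega
  by_cases hmem : N ∈ Finset.Ico 1 (2 * k + 1)
  · obtain ⟨u, hu⟩ := (IsUnit.prod_iff.2 hunit :
      IsUnit (∏ i ∈ (Finset.Ico 1 (2 * k + 1)).erase N, (1 - ((Q ^ (4 * (i : ℤ) + s) : Rˣ) : R))))
    refine ⟨(1 + ((Q ^ (n : ℤ) : Rˣ) : R)) * ((u⁻¹ : Rˣ) : R), ?_, fun h => ?_⟩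
    · rw [← Finset.mul_prod_erase _ _ hmem, ← hu, ← hn, hsplit]
      linear_combination ((1 + ((Q ^ (n : ℤ) : Rˣ) : R)) * (1 - ((Q ^ (n : ℤ) : Rˣ) : R))) *
        u.inv_mul
    · rw [map_mul, map_add, map_one, map_units_zpow, h]; ring
  · rw [Finset.erase_eq_of_notMem hmem] at hunit
    obtain ⟨u, hu⟩ := (IsUnit.prod_iff.2 hunit :
      IsUnit (∏ i ∈ Finset.Ico 1 (2 * k + 1), (1 - ((Q ^ (4 * (i : ℤ) + s) : Rˣ) : R))))
    refine ⟨(1 - ((Q ^ (2 * (n : ℤ)) : Rˣ) : R)) * ((u⁻¹ : Rˣ) : R), ?_, fun h => ?_⟩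
    · rw [← hu]
      linear_combination (1 - ((Q ^ (2 * (n : ℤ)) : Rˣ) : R)) * u.inv_mul
    · rw [hsplit, map_mul, map_mul, map_add, map_one, map_units_zpow, h]; ring

theorem map_eval_eq {S T : Type*} [CommRing S] [CommRing T] (f : S →+* T) (F : S[X]) (r : S) :
    f (F.eval r) = (F.map f).eval (f r) := by
  rw [eval_map, eval₂_at_apply]

theorem exists_mul_eq_of_isUnit {d : R} (hd : IsUnit d) (a : R) : ∃ c, c * d = a := by
  obtain ⟨c, hc⟩ := hd.dvd (a := a)
  exact ⟨c, by rw [hc, mul_comm]⟩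

/-- The difference of a `clearedSeries` and a series with constant denominators, multiplied by the
common denominator of the former. -/
noncomputable def clearedDifference (u v c d : ℕ → R) (N : ℕ) : R[X] :=
  clearedSeries u v c N - (∏ j ∈ Finset.range N, wellPoisedFactor (v j)) *
    ∑ k ∈ Finset.range (N + 1), C (d k) * ∏ j ∈ Finset.range k, wellPoisedFactor (u j)

theorem clearedDifference_map (f : R →+* K) (u v c d : ℕ → R) (N : ℕ) :
    (clearedDifference u v c d N).map f =
      clearedDifference (fun j => f (u j)) (fun j => f (v j)) (fun k => f (c k))
        (fun k => f (d k)) N := by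
  simp only [clearedDifference, Polynomial.map_sub, Polynomial.map_mul, Polynomial.map_prod,
    Polynomial.map_sum, clearedSeries_map, wellPoisedFactor_map, map_C]

theorem map_eq_of_mul_eq {f : R →+* K} {c d e : R} (h : c * d = e) (hd : f d ≠ 0) :
    f c = f e / f d := by
  rw [eq_div_iff hd, ← map_mul, h]

/-- The difference of the two truncated basic hypergeometric series, written uniformly in `N`. -/
noncomputable def seriesDifference (q : K) (s : ℤ) (N : ℕ) : K :=
  ∑ k ∈ Finset.range (N + 1),
      (-1) ^ k * ((1 + q ^ (8 * (k : ℤ) + s)) * qShiftedFactorial (q ^ (2 * s)) (q ^ 8) k /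
        ((1 + q ^ s) * qShiftedFactorial (q ^ 8) (q ^ 8) k)) *
        q ^ (4 * (k : ℤ) ^ 2 + 2 * (k : ℤ) * (4 - s)) *
        (qShiftedFactorial (q ^ (2 * s)) (q ^ 8) k * qShiftedFactorial (q ^ (2 * s)) (q ^ 8) k /
          (qShiftedFactorial (q ^ 8) (q ^ 8) k * qShiftedFactorial (q ^ 8) (q ^ 8) k)) -
    (-1) ^ N * ((1 - q ^ (8 * (N : ℤ) + 2 * s)) / (1 - q ^ (2 * s))) *
      q ^ ((N : ℤ) * (4 * N + 2 * s - 4)) *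
      ∑ k ∈ Finset.range (N + 1),
        qShiftedFactorial (q ^ (2 * s)) (q ^ 8) k *
          qShiftedFactorial (q ^ (2 * s)) (q ^ 8) k * qShiftedFactorial (q ^ 4) (q ^ 8) k /
          (qShiftedFactorial (q ^ 8) (q ^ 8) k * qShiftedFactorial (q ^ (4 + s)) (q ^ 8) k *
            qShiftedFactorial (q ^ (8 + s)) (q ^ 8) k) * q ^ (2 * (k : ℤ) * (4 - s))

/-- The ring `R` plays a local ring inside the function field `K`, with residue map `ρ`. Both series
have coefficients in `R`: the explicit denominators are units, and the possibly singular ones on the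
right are absorbed by `1 - q^{2n}`. Watson's identity, known in `K`, therefore yields a statement in
`R`. -/
theorem exists_cleared_difference [CharZero L] {n N : ℕ} {s : ℤ} (hs : s = 1 ∨ s = -1)
    (hN : 0 < N) (hn : (n : ℤ) = 4 * N + s) (ι : R →+* K) (hι : Function.Injective ι)
    (ρ : R →+* L) (hρ : ∀ x, ρ x ≠ 0 → IsUnit x) (Q : Rˣ)
    (hω : ∀ m : ℤ, ρ (Q : R) ^ m = 1 → (n : ℤ) ∣ m)
    (hK : ∀ m : ℤ, ι (Q : R) ^ m = 1 → m = 0) (q : K) (hq : q = ι (Q : R)) :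
    ∃ (F : R[X]) (w : R), IsUnit w ∧
      F.eval (((Q ^ (2 * (n : ℤ)) : Rˣ) : R) + ((Q ^ (-(2 * (n : ℤ))) : Rˣ) : R)) = 0 ∧
      ι (F.eval 2) = ι w *
        seriesDifference q s N ∧
      (ρ (Q : R) ^ (n : ℤ) = -1 → F.map ρ = 0) := by
  have hU : ∀ m : ℤ, ¬ (n : ℤ) ∣ m → IsUnit (1 - ((Q ^ m : Rˣ) : R)) := fun m hm =>
    hρ _ (by
      rw [map_sub, map_one, map_units_zpow]
      exact fun h => hm (hω m (sub_eq_zero.1 h).symm))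
  have hN1 : (1 : ℤ) ≤ N := by exact_mod_cast hN
  have h2s : ¬ (n : ℤ) ∣ 2 * s := fun h => by
    refine not_dvd_eight_mul hs hn (i := s) (by omega) ?_ ?_
    · rw [abs_le]; constructor <;> omega
    · rw [show 8 * s = 2 * s * 4 by ring]; exact h.mul_right 4
  have hU8 : ∀ k ≤ N, IsUnit (unitShiftedFactorial Q 8 k) := fun k hk =>
    IsUnit.prod_iff.2 fun j hj => hU _ (by
      have := Finset.mem_range.1 hj
      rw [show 8 + 8 * (j : ℤ) = 8 * (j + 1) by ring]
      refine not_dvd_eight_mul hs hn (by omega) ?_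
      rw [abs_le]; constructor <;> omega)
  have hUs : IsUnit (1 + ((Q ^ s : Rˣ) : R)) := hρ _ (by
    rw [map_add, map_one, map_units_zpow]
    intro h
    apply h2s
    apply hω
    rw [mul_comm, zpow_mul, show ρ (Q : R) ^ s = -1 by linear_combination h]
    norm_num)
  have hU2s := hU _ h2s
  -- Only `k ≤ N` matters; the value `0` elsewhere merely makes the coefficient sequences total. The
  -- same holds for `e` and `d` below.
  have hc : ∀ k : ℕ, ∃ c : R, k ≤ N → c * ((1 + ((Q ^ s : Rˣ) : R)) * unitShiftedFactorial Q 8 k) =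
      (-1) ^ k * ((1 + ((Q ^ (8 * (k : ℤ) + s) : Rˣ) : R)) * unitShiftedFactorial Q (2 * s) k) *
        ((Q ^ (4 * (k : ℤ) ^ 2 + 2 * (k : ℤ) * (4 - s)) : Rˣ) : R) := fun k => by
    by_cases hk : k ≤ N
    · exact (exists_mul_eq_of_isUnit (hUs.mul (hU8 k hk)) _).imp fun _ h _ => h
    · exact ⟨0, fun h => absurd h hk⟩
  have he : ∀ k : ℕ, ∃ e : R, k ≤ N →
      e * (unitShiftedFactorial Q (4 + s) k * unitShiftedFactorial Q (8 + s) k) =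
        1 - ((Q ^ (2 * (n : ℤ)) : Rˣ) : R) ∧ (ρ (Q : R) ^ (n : ℤ) = -1 → ρ e = 0) := fun k => by
    by_cases hk : k ≤ N
    · obtain ⟨e, he⟩ := exists_regular_quotient hs hn ρ Q hU hk
      exact ⟨e, fun _ => he⟩
    · exact ⟨0, fun h => absurd h hk⟩
  choose c hc using hc
  choose e he using he
  have hd : ∀ k : ℕ, ∃ d : R, k ≤ N →
      d * ((1 - ((Q ^ (2 * s) : Rˣ) : R)) * unitShiftedFactorial Q 8 k) =
      (-1) ^ N * ((Q ^ ((N : ℤ) * (4 * N + 2 * s - 4)) : Rˣ) : R) * unitShiftedFactorial Q 4 k *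
        ((Q ^ (2 * (k : ℤ) * (4 - s)) : Rˣ) : R) * e k := fun k => by
    by_cases hk : k ≤ N
    · exact (exists_mul_eq_of_isUnit (hU2s.mul (hU8 k hk)) _).imp fun _ h _ => h
    · exact ⟨0, fun h => absurd h hk⟩
  choose d hd using hd
  have hq0 : q ≠ 0 := hq ▸ map_units_ne_zero ι Q
  rw [← hq] at hK
  have ne1 : ∀ m : ℤ, m ≠ 0 → 1 - q ^ m ≠ 0 := fun m hm h =>
    hm (hK m (sub_eq_zero.1 h).symm)
  have z8 : ∀ i : ℕ, (q ^ 8) ^ i = q ^ (8 * (i : ℤ)) := fun i => by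
    rw [← pow_mul, ← zpow_natCast]; push_cast; rfl
  have p4 : q ^ 4 = q ^ (4 : ℤ) := (zpow_natCast q 4).symm
  have p8 : q ^ 8 = q ^ (8 : ℤ) := (zpow_natCast q 8).symm
  have nq : ∀ (e : ℤ) (k : ℕ), (∀ j : ℕ, j < k → e + 8 * (j : ℤ) ≠ 0) →
      qShiftedFactorial (q ^ e) (q ^ 8) k ≠ 0 := fun e k h =>
    qShiftedFactorial_ne_zero fun j hj => by
      rw [z8, ← zpow_add₀ hq0]; exact ne1 _ (h j hj)
  have n2 : 2 * (n : ℤ) = 8 * N + 2 * s := by rw [hn]; ring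
  have ιc : ∀ k ≤ N, ι (c k) = (-1) ^ k * ((1 + q ^ (8 * (k : ℤ) + s)) *
      qShiftedFactorial (q ^ (2 * s)) (q ^ 8) k /
        ((1 + q ^ s) * qShiftedFactorial (q ^ 8) (q ^ 8) k)) *
        q ^ (4 * (k : ℤ) ^ 2 + 2 * (k : ℤ) * (4 - s)) := fun k hk => by
    rw [map_eq_of_mul_eq (hc k hk) ((hUs.mul (hU8 k hk)).map ι).ne_zero]
    simp only [map_mul, map_add, map_one, map_pow, map_neg, map_units_zpow,
      map_unitShiftedFactorial, ← hq, p8]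
    ring
  have ρc : ∀ k ≤ N, ρ (c k) = (-1) ^ k * ((1 + ρ (Q : R) ^ (8 * (k : ℤ) + s)) *
      qShiftedFactorial (ρ (Q : R) ^ (2 * s)) (ρ (Q : R) ^ 8) k /
        ((1 + ρ (Q : R) ^ s) * qShiftedFactorial (ρ (Q : R) ^ 8) (ρ (Q : R) ^ 8) k)) *
        ρ (Q : R) ^ (4 * (k : ℤ) ^ 2 + 2 * (k : ℤ) * (4 - s)) := fun k hk => by
    rw [map_eq_of_mul_eq (hc k hk) ((hUs.mul (hU8 k hk)).map ρ).ne_zero]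
    have p8 : ρ (Q : R) ^ (8 : ℤ) = ρ (Q : R) ^ 8 := zpow_natCast _ 8
    simp only [map_mul, map_add, map_one, map_pow, map_neg, map_units_zpow,
      map_unitShiftedFactorial, p8]
    ring
  have ιd : ∀ k ≤ N, ι (d k) =
      (-1) ^ N * ((1 - q ^ (8 * (N : ℤ) + 2 * s)) / (1 - q ^ (2 * s))) *
          q ^ ((N : ℤ) * (4 * N + 2 * s - 4)) * (qShiftedFactorial (q ^ 4) (q ^ 8) k /
              (qShiftedFactorial (q ^ 8) (q ^ 8) k * qShiftedFactorial (q ^ (4 + s)) (q ^ 8) k *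
                qShiftedFactorial (q ^ (8 + s)) (q ^ 8) k) * q ^ (2 * (k : ℤ) * (4 - s))) := by
    intro k hk
    have hne : ι (unitShiftedFactorial Q (4 + s) k * unitShiftedFactorial Q (8 + s) k) ≠ 0 := by
      rw [map_mul, map_unitShiftedFactorial, map_unitShiftedFactorial, ← hq]
      exact mul_ne_zero (nq _ _ fun j _ => by omega) (nq _ _ fun j _ => by omega)
    rw [map_eq_of_mul_eq (hd k hk) ((hU2s.mul (hU8 k hk)).map ι).ne_zero, map_mul ι _ (e k),
      map_eq_of_mul_eq (he k hk).1 hne, n2]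
    simp only [map_mul, map_sub, map_one, map_pow, map_neg, map_units_zpow,
      map_unitShiftedFactorial, ← hq, p8, p4]
    simp only [div_eq_mul_inv, mul_inv]
    ring
  have ρd : ρ (Q : R) ^ (n : ℤ) = -1 → ∀ k ≤ N, ρ (d k) = 0 := fun h k hk => by
    rw [map_eq_of_mul_eq (hd k hk) ((hU2s.mul (hU8 k hk)).map ρ).ne_zero, map_mul ρ _ (e k),
      (he k hk).2 h, mul_zero, zero_div]
  set u : ℕ → R := fun j => ((Q ^ (2 * s + 8 * (j : ℤ)) : Rˣ) : R) with hu
  set v : ℕ → R := fun j => ((Q ^ (8 + 8 * (j : ℤ)) : Rˣ) : R) with hv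
  have hιu : ∀ j, ι (u j) = q ^ (2 * s) * (q ^ 8) ^ j := fun j => by
    rw [hu, map_units_zpow, ← hq, z8, zpow_add₀ hq0]
  have hιv : ∀ j, ι (v j) = q ^ 8 * (q ^ 8) ^ j := fun j => by
    rw [hv, map_units_zpow, ← hq, z8, zpow_add₀ hq0, p8]
  set F : R[X] := clearedDifference u v c d N with hF
  have hFx : ∀ x : K, x ≠ 0 → qShiftedFactorial (q ^ 8 * x) (q ^ 8) N ≠ 0 →
      qShiftedFactorial (q ^ 8 * x⁻¹) (q ^ 8) N ≠ 0 → (F.map ι).eval (x + x⁻¹) =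
      qShiftedFactorial (q ^ 8 * x) (q ^ 8) N * qShiftedFactorial (q ^ 8 * x⁻¹) (q ^ 8) N *
      (∑ k ∈ Finset.range (N + 1),
      (-1) ^ k * ((1 + q ^ (8 * (k : ℤ) + s)) * qShiftedFactorial (q ^ (2 * s)) (q ^ 8) k /
        ((1 + q ^ s) * qShiftedFactorial (q ^ 8) (q ^ 8) k)) *
        q ^ (4 * (k : ℤ) ^ 2 + 2 * (k : ℤ) * (4 - s)) *
        (qShiftedFactorial (q ^ (2 * s) * x) (q ^ 8) k *
          qShiftedFactorial (q ^ (2 * s) * x⁻¹) (q ^ 8) k /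
          (qShiftedFactorial (q ^ 8 * x) (q ^ 8) k * qShiftedFactorial (q ^ 8 * x⁻¹) (q ^ 8) k)) -
    (-1) ^ N * ((1 - q ^ (8 * (N : ℤ) + 2 * s)) / (1 - q ^ (2 * s))) *
      q ^ ((N : ℤ) * (4 * N + 2 * s - 4)) *
      ∑ k ∈ Finset.range (N + 1),
        qShiftedFactorial (q ^ (2 * s) * x) (q ^ 8) k *
          qShiftedFactorial (q ^ (2 * s) * x⁻¹) (q ^ 8) k * qShiftedFactorial (q ^ 4) (q ^ 8) k /
          (qShiftedFactorial (q ^ 8) (q ^ 8) k * qShiftedFactorial (q ^ (4 + s)) (q ^ 8) k *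
            qShiftedFactorial (q ^ (8 + s)) (q ^ 8) k) * q ^ (2 * (k : ℤ) * (4 - s))) := by
    intro x hx h1 h2
    rw [hF, clearedDifference_map, clearedDifference, eval_sub, clearedSeries_eval _ _ _ hx _ _ _ hιu hιv N h1 h2, eval_mul,
      prod_wellPoisedFactor_eval _ _ hx _ hιv, eval_finsetSum, ← mul_sub]
    congr 2
    · refine Finset.sum_congr rfl fun k hk => ?_
      rw [ιc k (Nat.lt_succ_iff.1 (Finset.mem_range.1 hk))]
    · rw [Finset.mul_sum]
      refine Finset.sum_congr rfl fun k hk => ?_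
      rw [eval_mul, eval_C, prod_wellPoisedFactor_eval _ _ hx _ hιu,
        ιd k (Nat.lt_succ_iff.1 (Finset.mem_range.1 hk))]
      simp only [div_eq_mul_inv, mul_inv]
      ring
  have np : qShiftedFactorial (q ^ 8) (q ^ 8) N ≠ 0 := by
    have := nq 8 N fun j _ => by omega
    rwa [← p8] at this
  refine ⟨F, unitShiftedFactorial Q 8 N * unitShiftedFactorial Q 8 N,
    (hU8 N le_rfl).mul (hU8 N le_rfl), ?_, ?_, ?_⟩
  · apply hι
    have hx0 : q ^ (2 * (n : ℤ)) ≠ 0 := zpow_ne_zero _ hq0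
    rw [map_eval_eq, map_add, map_units_zpow, map_units_zpow, ← hq, map_zero, zpow_neg,
      hFx _ hx0, watson_specialised q hq0 hK s hs N _ (by rw [n2]), sub_self, mul_zero]
    · rw [p8, ← zpow_add₀ hq0, ← p8]
      exact nq _ _ fun j _ => by omega
    · rw [← zpow_neg, p8, ← zpow_add₀ hq0, ← p8]
      exact nq _ _ fun j hj => by omega
  -- The undeformed series sit at `x = 1`, where `x + x⁻¹ = 2`.
  · have := hFx 1 one_ne_zero (by rwa [mul_one]) (by rwa [inv_one, mul_one])
    simp only [inv_one, mul_one] at this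
    rw [one_add_one_eq_two] at this
    rw [map_eval_eq, map_mul, map_unitShiftedFactorial, ← hq, ← p8, map_ofNat, this,
      seriesDifference]
  · intro h
    have hω0 := map_units_ne_zero ρ Q
    have hz := clearedSeries_eq_zero (ρ (Q : R)) hω0 s N (by rw [← hn]; exact h) (fun j hj h0 => by
      have h8 := ((hU8 N le_rfl).map ρ).ne_zero
      rw [map_unitShiftedFactorial, show ρ (Q : R) ^ (8 : ℤ) = ρ (Q : R) ^ 8 from
        zpow_natCast _ 8] at h8
      exact (Finset.prod_ne_zero_iff.1 h8) j (Finset.mem_range.2 hj) h0)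
    rw [hF, clearedDifference_map, clearedDifference, Finset.sum_eq_zero, mul_zero, sub_zero, ← hz]
    · simp only [clearedSeries, hu, hv, map_units_zpow]
      refine Finset.sum_congr rfl fun k hk => ?_
      rw [ρc k (Nat.lt_succ_iff.1 (Finset.mem_range.1 hk))]
    · intro k hk
      rw [ρd h k (Nat.lt_succ_iff.1 (Finset.mem_range.1 hk)), C_0, zero_mul]

end LocalCongruence

/-! ### From vanishing at `x = q^{2n}` to divisibility of the numerator. -/

section Localization

/-- The map `x ↦ x + x⁻¹` is ramified at `x = 1`, so `x ≡ 1` modulo `π` already gives `y ≡ 2` modulo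
`π²`. If all coefficients of `F` are divisible by `π`, one further power is gained. -/
theorem pow_dvd_of_cleared_difference {R L : Type*} [CommRing R] [Field L] {n : ℕ} (ρ : R →+* L)
    (π : R) (hker : ∀ x, ρ x = 0 → π ∣ x) (Q : Rˣ) (hω : ρ (Q : R) ^ (2 * (n : ℤ)) = 1)
    (F : R[X])
    (hF : F.eval (((Q ^ (2 * (n : ℤ)) : Rˣ) : R) + ((Q ^ (-(2 * (n : ℤ))) : Rˣ) : R)) = 0) :
    π ^ 2 ∣ F.eval 2 ∧ (F.map ρ = 0 → π ^ 3 ∣ F.eval 2) := by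
  set y := ((Q ^ (2 * (n : ℤ)) : Rˣ) : R) + ((Q ^ (-(2 * (n : ℤ))) : Rˣ) : R) with hy
  have h1 : π ∣ 1 - ((Q ^ (2 * (n : ℤ)) : Rˣ) : R) := hker _ (by
    rw [map_sub, map_one, map_units_zpow, hω, sub_self])
  have h2 : π ^ 2 ∣ 2 - y := by
    have : 2 - y = -((Q ^ (-(2 * (n : ℤ))) : Rˣ) : R) *
        (1 - ((Q ^ (2 * (n : ℤ)) : Rˣ) : R)) ^ 2 := by
      have hm : ((Q ^ (-(2 * (n : ℤ))) : Rˣ) : R) * ((Q ^ (2 * (n : ℤ)) : Rˣ) : R) = 1 := by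
        rw [← Units.val_mul, ← zpow_add, neg_add_cancel, zpow_zero, Units.val_one]
      rw [hy]
      linear_combination (-2 + ((Q ^ (2 * (n : ℤ)) : Rˣ) : R)) * hm
    rw [this]
    exact (pow_dvd_pow_of_dvd h1 2).mul_left _
  refine ⟨?_, fun hmap => ?_⟩
  · have := sub_dvd_eval_sub 2 y F
    rw [hF, sub_zero] at this
    exact h2.trans this
  · have : C π ∣ F := (C_dvd_iff_dvd_coeff _ _).2 fun i => hker _ (by
      rw [← coeff_map, hmap, coeff_zero])
    obtain ⟨G, rfl⟩ := this
    have hG := h2.trans (sub_dvd_eval_sub 2 y G)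
    rw [eval_mul, eval_C] at hF ⊢
    -- Only `π G(y) = 0` is used, so `π` need not be cancelled.
    have : π * G.eval 2 = π * (G.eval 2 - G.eval y) := by rw [mul_sub, hF, sub_zero]
    rw [this, pow_succ']
    exact mul_dvd_mul_left π hG

theorem RatFunc.X_zpow_eq_one {m : ℤ} (h : (RatFunc.X : RatFunc ℚ) ^ m = 1) : m = 0 := by
  have key : ∀ i : ℕ, (RatFunc.X : RatFunc ℚ) ^ i = 1 → i = 0 := fun i hi => by
    rw [← RatFunc.algebraMap_X, ← map_pow, ← map_one (algebraMap ℚ[X] (RatFunc ℚ))] at hi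
    have := congrArg natDegree (RatFunc.algebraMap_injective ℚ hi)
    simpa using this
  obtain ⟨i, rfl | rfl⟩ := m.eq_nat_or_neg
  · rw [zpow_natCast] at h
    exact_mod_cast key i h
  · rw [zpow_neg, zpow_natCast, inv_eq_one] at h
    simpa using key i h

theorem RatFunc.pow_dvd_num {P : ℚ[X]} (hP : Prime P) {f : RatFunc ℚ} {a b : ℚ[X]} {e : ℕ}
    (hb : ¬ P ∣ b) (h : f * algebraMap ℚ[X] (RatFunc ℚ) b =
      algebraMap ℚ[X] (RatFunc ℚ) (P ^ e * a)) : P ^ e ∣ f.num := by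
  apply hP.pow_dvd_of_dvd_mul_right e hb
  have hd : algebraMap ℚ[X] (RatFunc ℚ) f.denom ≠ 0 :=
    RatFunc.algebraMap_ne_zero f.denom_ne_zero
  rw [← RatFunc.num_div_denom f, div_mul_eq_mul_div, div_eq_iff hd, ← map_mul, ← map_mul] at h
  rw [RatFunc.algebraMap_injective ℚ h, mul_assoc]
  exact dvd_mul_right _ _

theorem pow_dvd_num_seriesDifference {L : Type*} [Field L] [Algebra ℚ L] {P : ℚ[X]}
    (hP : Prime P) {ω : L} (hω0 : ω ≠ 0) (hPω : ∀ p : ℚ[X], aeval ω p = 0 ↔ P ∣ p)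
    {n N : ℕ} {s : ℤ} (hs : s = 1 ∨ s = -1) (hN : 0 < N) (hn : (n : ℤ) = 4 * N + s)
    (hω : ∀ m : ℤ, ω ^ m = 1 → (n : ℤ) ∣ m) (hω2 : ω ^ (2 * (n : ℤ)) = 1) :
    P ^ 2 ∣ (seriesDifference (RatFunc.X : RatFunc ℚ) s N).num ∧
      (ω ^ (n : ℤ) = -1 → P ^ 3 ∣ (seriesDifference (RatFunc.X : RatFunc ℚ) s N).num) := by
  have : CharZero L := algebraRat.charZero L
  -- These are the polynomials not vanishing at `ω`, so `Localization M` is `ℚ[X]` localized at the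
  -- prime `(P)`; `ι` embeds it in `ℚ(X)` and `ρ` evaluates at `ω`.
  set M : Submonoid ℚ[X] := (nonZeroDivisors L).comap (aeval ω : ℚ[X] →ₐ[ℚ] L) with hM
  have memM : ∀ {b : ℚ[X]}, b ∈ M ↔ aeval ω b ≠ 0 := fun {b} => by
    rw [hM, Submonoid.mem_comap, mem_nonZeroDivisors_iff_ne_zero]
  have hM0 : ∀ {b : ℚ[X]}, b ∈ M → b ≠ 0 := fun {b} hb h => by
    rw [memM, h, map_zero] at hb; exact hb rfl
  have hg : ∀ y : M, IsUnit (algebraMap ℚ[X] (RatFunc ℚ) y) := fun y =>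
    (RatFunc.algebraMap_ne_zero (hM0 y.2)).isUnit
  have hg' : ∀ y : M, IsUnit ((aeval ω : ℚ[X] →ₐ[ℚ] L).toRingHom y) := fun y =>
    (memM.1 y.2 : aeval ω (y : ℚ[X]) ≠ 0).isUnit
  set ι : Localization M →+* RatFunc ℚ := IsLocalization.lift hg with hιdef
  set ρ : Localization M →+* L := IsLocalization.lift hg' with hρdef
  have hιa : ∀ a, ι (algebraMap ℚ[X] (Localization M) a) = algebraMap ℚ[X] (RatFunc ℚ) a :=
    fun a => IsLocalization.lift_eq hg a
  have hρa : ∀ a, ρ (algebraMap ℚ[X] (Localization M) a) = aeval ω a :=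
    fun a => IsLocalization.lift_eq hg' a
  have hι : Function.Injective ι := by
    rw [hιdef, IsLocalization.lift_injective_iff]
    intro x y
    rw [(IsLocalization.injective (Localization M)
      (le_nonZeroDivisors_of_noZeroDivisors fun h => hM0 h rfl)).eq_iff,
      (RatFunc.algebraMap_injective ℚ).eq_iff]
  have hsurj : ∀ x : Localization M, ∃ a b : ℚ[X], b ∈ M ∧
      x * algebraMap ℚ[X] (Localization M) b = algebraMap ℚ[X] (Localization M) a := fun x => by
    obtain ⟨⟨a, b⟩, h⟩ := IsLocalization.surj M x
    exact ⟨a, b, b.2, h⟩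
  have hunit : ∀ {b : ℚ[X]}, b ∈ M → IsUnit (algebraMap ℚ[X] (Localization M) b) :=
    fun {b} hb => IsLocalization.map_units (Localization M) ⟨b, hb⟩
  have hρu : ∀ x, ρ x ≠ 0 → IsUnit x := fun x hx => by
    obtain ⟨a, b, hb, h⟩ := hsurj x
    have h1 := congrArg ρ h
    rw [map_mul, hρa, hρa] at h1
    have ha : a ∈ M := memM.2 (h1 ▸ mul_ne_zero hx (memM.1 hb))
    exact isUnit_of_mul_isUnit_left (h ▸ hunit ha)
  have hker : ∀ x, ρ x = 0 → algebraMap ℚ[X] (Localization M) P ∣ x := fun x hx => by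
    obtain ⟨a, b, hb, h⟩ := hsurj x
    have h1 := congrArg ρ h
    rw [map_mul, hρa, hρa, hx, zero_mul] at h1
    have h2 : algebraMap ℚ[X] (Localization M) P ∣ algebraMap ℚ[X] (Localization M) a :=
      map_dvd _ ((hPω a).1 h1.symm)
    rw [← h] at h2
    exact (hunit hb).dvd_mul_right.1 h2
  obtain ⟨Q, hQ⟩ : IsUnit (algebraMap ℚ[X] (Localization M) X) :=
    hunit (memM.2 (by rwa [aeval_X]))
  have hρQ : ρ (Q : Localization M) = ω := by rw [hQ, hρa, aeval_X]
  have hιQ : ι (Q : Localization M) = RatFunc.X := by rw [hQ, hιa, RatFunc.algebraMap_X]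
  obtain ⟨F, w, ⟨w, rfl⟩, hF0, hF2, hFρ⟩ := exists_cleared_difference hs hN hn ι hι ρ hρu Q
    (by rwa [hρQ]) (by rw [hιQ]; exact fun m => RatFunc.X_zpow_eq_one) RatFunc.X hιQ.symm
  obtain ⟨d2, d3⟩ := pow_dvd_of_cleared_difference ρ _ hker Q (by rwa [hρQ]) F hF0
  rw [hρQ] at hFρ
  have final : ∀ e : ℕ, algebraMap ℚ[X] (Localization M) P ^ e ∣ F.eval 2 →
      P ^ e ∣ (seriesDifference (RatFunc.X : RatFunc ℚ) s N).num := by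
    rintro e ⟨g, hg⟩
    obtain ⟨a, b, hb, h⟩ := hsurj (((w⁻¹ : (Localization M)ˣ) : Localization M) * g)
    refine RatFunc.pow_dvd_num hP (b := b) (a := a) (fun hPb => memM.1 hb ((hPω b).2 hPb)) ?_
    have hD : seriesDifference (RatFunc.X : RatFunc ℚ) s N =
        ι (((w⁻¹ : (Localization M)ˣ) : Localization M) * F.eval 2) := by
      rw [map_mul, hF2, ← mul_assoc, ← map_mul, w.inv_mul, map_one, one_mul]
    rw [hD, hg, ← hιa, ← hιa, ← map_mul, map_mul _ _ a, map_pow, ← h]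
    congr 1
    ring
  exact ⟨final 2 d2, fun h => final 3 (d3 (hFρ h))⟩

end Localization

/-! ### The moduli `Φ_n(q)` and `Φ_n(-q)`, and the main theorem. -/

theorem aeval_cyclotomic_root_iff {n : ℕ} (hn : 0 < n) {ζ : ℂ} (hζ : IsPrimitiveRoot ζ n)
    (p : ℚ[X]) : aeval ζ p = 0 ↔ cyclotomic n ℚ ∣ p := by
  rw [cyclotomic_eq_minpoly_rat hζ hn, minpoly.dvd_iff]

theorem aeval_neg_cyclotomic_root_iff {n : ℕ} (hn : 0 < n) {ζ : ℂ} (hζ : IsPrimitiveRoot ζ n)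
    (p : ℚ[X]) : aeval (-ζ) p = 0 ↔ (cyclotomic n ℚ).comp (-X) ∣ p := by
  have h1 : aeval (-ζ) p = aeval ζ (p.comp (-X)) := by
    rw [aeval_comp, map_neg, aeval_X]
  have h2 : ∀ r : ℚ[X], (r.comp (-X)).comp (-X) = r := fun r => by
    rw [comp_assoc]; simp
  rw [h1, aeval_cyclotomic_root_iff hn hζ]
  constructor
  · rintro ⟨r, hr⟩
    refine ⟨r.comp (-X), ?_⟩
    rw [← mul_comp, ← hr, h2]
  · rintro ⟨r, rfl⟩
    rw [mul_comp, h2]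
    exact dvd_mul_right _ _

theorem prime_cyclotomic_comp_neg {n : ℕ} (hn : 0 < n) : Prime ((cyclotomic n ℚ).comp (-X)) := by
  have h : (cyclotomic n ℚ).comp (-X) = (algEquivAevalNegX : ℚ[X] ≃ₐ[ℚ] ℚ[X]) (cyclotomic n ℚ) := by
    rw [comp_eq_aeval]; rfl
  rw [h]
  exact (MulEquiv.prime_iff (algEquivAevalNegX : ℚ[X] ≃ₐ[ℚ] ℚ[X]).toMulEquiv).2
    (cyclotomic.irreducible_rat hn).prime

theorem isCoprime_cyclotomic_comp_neg {n : ℕ} (hn : Odd n) :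
    IsCoprime ((cyclotomic n ℚ).comp (-X)) (cyclotomic n ℚ) := by
  have h1 : cyclotomic n ℚ ∣ X ^ n - 1 := cyclotomic.dvd_X_pow_sub_one n ℚ
  have h2 : (cyclotomic n ℚ).comp (-X) ∣ -X ^ n - 1 := by
    obtain ⟨r, hr⟩ := h1
    refine ⟨r.comp (-X), ?_⟩
    rw [← mul_comp, ← hr]
    simp [hn.neg_pow]
  refine IsCoprime.of_isCoprime_of_dvd_left (IsCoprime.of_isCoprime_of_dvd_right ?_ h1) h2
  -- The two multiples `-X^n - 1` and `X^n - 1` add up to `-2`.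
  refine ⟨C (-1 / 2), C (-1 / 2), ?_⟩
  have : (C (-1 / 2) * (-2) : ℚ[X]) = 1 := by
    rw [show (-2 : ℚ[X]) = C (-2) by rw [map_neg, map_ofNat], ← C_mul]; norm_num
  linear_combination this

theorem theorem2 (n : ℕ) (hn : 0 < n) (s : ℤ) (hs : s = 1 ∨ s = -1)
    (hns : (n : ℤ) ≡ s [ZMOD 4]) (q : RatFunc ℚ) (hq : q = RatFunc.X) :
    RatFuncCongruent
      ((cyclotomic n ℚ).comp (-X) ^ 3 * cyclotomic n ℚ ^ 2)
      (∑ k ∈ Finset.range ((((n : ℤ) - s) / 4).toNat + 1),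
        (-1) ^ k *
          ((1 + q ^ (8 * (k : ℤ) + s)) * qShiftedFactorial (q ^ (2 * s)) (q ^ 8) k ^ 3 /
            ((1 + q ^ s) * qShiftedFactorial (q ^ 8) (q ^ 8) k ^ 3)) *
          q ^ (4 * (k : ℤ) ^ 2 + 2 * (k : ℤ) * (4 - s)))
      ((-1) ^ (((n : ℤ) - s) / 4) * (qInteger (q ^ 2) n / qInteger (q ^ 2) s) *
        q ^ (((n : ℤ) - s) * ((n : ℤ) + s - 4) / 4) *
        ∑ k ∈ Finset.range ((((n : ℤ) - s) / 4).toNat + 1),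
          qShiftedFactorial (q ^ (2 * s)) (q ^ 8) k ^ 2 * qShiftedFactorial (q ^ 4) (q ^ 8) k /
            (qShiftedFactorial (q ^ 8) (q ^ 8) k * qShiftedFactorial (q ^ (4 + s)) (q ^ 8) k *
              qShiftedFactorial (q ^ (8 + s)) (q ^ 8) k) *
          q ^ (2 * (k : ℤ) * (4 - s))) := by
  obtain ⟨N, hN⟩ : ∃ N : ℕ, (n : ℤ) = 4 * N + s := by
    obtain ⟨c, hc⟩ := hns.symm.dvd
    exact ⟨c.toNat, by omega⟩
  have e1 : ((n : ℤ) - s) / 4 = N := by omega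
  have e2 : ((n : ℤ) - s) * ((n : ℤ) + s - 4) / 4 = N * (4 * N + 2 * s - 4) := by
    rw [show ((n : ℤ) - s) * ((n : ℤ) + s - 4) = 4 * (N * (4 * N + 2 * s - 4)) by rw [hN]; ring]
    exact Int.mul_ediv_cancel_left _ (by norm_num)
  have hq0 : q ≠ 0 := hq ▸ RatFunc.X_ne_zero
  have ne1 : ∀ m : ℤ, m ≠ 0 → 1 - q ^ m ≠ 0 := fun m hm h =>
    hm (RatFunc.X_zpow_eq_one (hq ▸ (sub_eq_zero.1 h).symm))
  have z2 : ∀ m : ℤ, (q ^ 2) ^ m = q ^ (2 * m) := fun m => by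
    rw [← zpow_natCast q 2, ← zpow_mul]; rfl
  have e3 : qInteger (q ^ 2) n / qInteger (q ^ 2) s =
      (1 - q ^ (8 * (N : ℤ) + 2 * s)) / (1 - q ^ (2 * s)) := by
    rw [qInteger, qInteger, z2, z2, show 2 * (n : ℤ) = 8 * N + 2 * s by rw [hN]; ring]
    have h2 : 1 - q ^ 2 ≠ 0 := by simpa using ne1 2 (by norm_num)
    rw [div_div_div_cancel_right₀ h2]
  have hD : ∀ A B : RatFunc ℚ, A - B = seriesDifference q s N →
      RatFuncCongruent ((cyclotomic n ℚ).comp (-X) ^ 3 * cyclotomic n ℚ ^ 2) A B := by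
    intro A B hAB
    rw [RatFuncCongruent, hAB]
    -- For `N = 0`, that is `n = s = 1`, both sides are equal; the local argument needs `N > 0` for
    -- `1 - q^{2s}` to be a unit.
    rcases Nat.eq_zero_or_pos N with rfl | hN0
    · have h2s : 1 - q ^ (2 * s) ≠ 0 := ne1 _ (by omega)
      have hs1 : 1 + q ^ s ≠ 0 := fun h => h2s (by
        rw [mul_comm, zpow_mul, show q ^ s = -1 by linear_combination h]; norm_num)
      have : seriesDifference q s 0 = 0 := by
        simp [seriesDifference, qShiftedFactorial_zero, div_self h2s, div_self hs1]
      rw [this, RatFunc.num_zero]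
      exact dvd_zero _
    · have hζ := Complex.isPrimitiveRoot_exp n hn.ne'
      set ζ := Complex.exp (2 * Real.pi * Complex.I / n)
      have hζ0 : ζ ≠ 0 := hζ.ne_zero hn.ne'
      have hodd : Odd n := by
        rw [← Nat.not_even_iff_odd, even_iff_two_dvd]; omega
      have hodd' : Odd (n : ℤ) := by exact_mod_cast hodd
      have hζn : ζ ^ (n : ℤ) = 1 := by rw [zpow_natCast, hζ.pow_eq_one]
      rw [hq]
      apply ((isCoprime_cyclotomic_comp_neg hodd).pow).mul_dvd
      -- The root used for `Φ_n(-q)` is `-ζ`; as `n` is odd, `(-ζ)^n = -1`, which gives the cube.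
      · refine (pow_dvd_num_seriesDifference (prime_cyclotomic_comp_neg hn) (neg_ne_zero.2 hζ0)
          (aeval_neg_cyclotomic_root_iff hn hζ) hs hN0 hN ?_ ?_).2 ?_
        · intro m hm
          have h2 : ζ ^ (2 * m) = 1 := by
            have : (-ζ) ^ (2 * m) = 1 := by rw [mul_comm, zpow_mul, hm, one_zpow]
            rwa [(even_two_mul m).neg_zpow] at this
          have h3 := (hζ.zpow_eq_one_iff_dvd _).1 h2
          have hc : IsCoprime (n : ℤ) 2 := by
            obtain ⟨k, hk⟩ := hodd'
            exact ⟨1, -k, by rw [hk]; ring⟩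
          exact hc.dvd_of_dvd_mul_left h3
        · rw [(even_two_mul (n : ℤ)).neg_zpow, mul_comm, zpow_mul, hζn, one_zpow]
        · rw [hodd'.neg_zpow, hζn]
      · refine (pow_dvd_num_seriesDifference (cyclotomic.irreducible_rat hn).prime hζ0
          (aeval_cyclotomic_root_iff hn hζ) hs hN0 hN ?_ ?_).1
        · exact fun m hm => (hζ.zpow_eq_one_iff_dvd _).1 hm
        · rw [mul_comm, zpow_mul, hζn, one_zpow]
  apply hD
  rw [e1, e2, e3, Int.toNat_natCast, zpow_natCast, seriesDifference]
  congr 1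
  · refine Finset.sum_congr rfl fun k _ => ?_
    simp only [div_eq_mul_inv, mul_inv]
    ring
  · congr 1
    refine Finset.sum_congr rfl fun k _ => ?_
    rw [pow_two (qShiftedFactorial (q ^ (2 * s)) (q ^ 8) k)]
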